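/- Let $n\ge 1$, $\vec p=(p_1,\dots,p_n)$ with $1<p_i<\infty$, $1<\theta\le\infty$, $1<v<\infty$, and let $w$ be a non-negative measurable function on $(0,\infty)$. For measurable $F:\mathbb R^n\to[0,\infty]$ put $$\|F\|_{LM_{\vec p\theta,w}}:=\Big\|\,w(r)\,\|F\|_{L_{\vec p}(Q(0,r))}\Big\|_{L_\theta(0,\infty)},\qquad Q(0,r)=(-r,r)^n,$$ where $\|F\|_{L_{\vec p}(Q)}=\|F\chi_Q\|_{L_{\vec p}}$ and $\|F\|_{L_{\vec p}}=\Big(\int_{\mathbb R}\cdots\Big(\int_{\mathbb R}F(x)^{p_1}dx_1\Big)^{p_2/p_1}\cdots dx_n\Big)^{1/p_n}$, and for complex-valued measurable $f$ put $\|f\|_{LM_{\vec p\theta,w}}:=\|\,|f|\,\|_{LM_{\vec p\theta,w}}$. Let $Mf(x)=\sup_{B\ni x}\frac1{|B|}\int_B|f(y)|\,dy$, the supremum being over all open balls $B$ containing $x$, be the Hardy–Littlewood maximal function. Define the weights $$\hat v_1(r)=r^{\sum_{i=1}^n\frac1{p_i}+1}\,w(r),\qquad \hat v_2(r)=r^{\sum_{i=1}^n\frac1{p_i}}\,w(r),$$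 and assume that the dual Hardy operator $H^*g(r)=\int_r^\infty g(t)\,dt$ is bounded from $L_{\theta,\hat v_1}(0,\infty)$ to $L_{\theta,\hat v_2}(0,\infty)$, that is, for some constant $A$, $\|\hat v_2H^*g\|_{L_\theta(0,\infty)}\le A\|\hat v_1g\|_{L_\theta(0,\infty)}$ for all measurable $g\ge0$ on $(0,\infty)$. Then there is a constant $C<\infty$, depending only on $n,\vec p,\theta,v,w$, such that for all measurable $f,f_1,f_2,\dots:\mathbb R^n\to\mathbb C$ (the right-hand sides may be infinite) $$\|Mf\|_{LM_{\vec p\theta,w}}\le C\|f\|_{LM_{\vec p\theta,w}},$$ $$\Big\|\Big(\sum_{j=1}^\infty (Mf_j)^v\Big)^{1/v}\Big\|_{LM_{\vec p\theta,w}}\le C\,\Big\|\Big(\sum_{j=1}^\infty|f_j|^v\Big)^{1/v}\Big\|_{LM_{\vec p\theta,w}},$$ and $$\Big\|M\Big[\sup_{j}|f_j|\Big]\Big\|_{LM_{\vec p\theta,w}}\le C\,\Big\|\sup_{j}|f_j|\Big\|_{LM_{\vec p\theta,w}}.$$ -/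

import Mathlib

open MeasureTheory Set
open scoped ENNReal NNReal

noncomputable section

namespace LocalMixedMorrey

/-- The mixed Lebesgue norm of a function `F ≥ 0` on `ℝ^n` with exponents `p = (p_1, …, p_n)`,
`0 < p_i < ∞`:
`(∫ ⋯ (∫ (∫ F(x)^{p_1} dx_1)^{p_2/p_1} dx_2)^{p_3/p_2} ⋯ dx_n)^{1/p_n}`.
The innermost integration is over the first coordinate; the resulting function of the remaining
coordinates is then measured with the remaining exponents. -/
def mixedNorm : (n : ℕ) → (Fin n → ℝ) → ((Fin n → ℝ) → ℝ≥0∞) → ℝ≥0∞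
  | 0, _, F => F Fin.elim0
  | n + 1, p, F =>
      mixedNorm n (fun i => p i.succ)
        (fun y => (∫⁻ s : ℝ, F (Fin.cons s y) ^ p 0) ^ (1 / p 0))

/-- The open cube `Q(0, r)` in `ℝ^n`, centred at the origin, with sides parallel to the axes. -/
def cube (n : ℕ) (r : ℝ) : Set (EuclideanSpace ℝ (Fin n)) :=
  {x | ∀ i, |x i| < r}

/-- The norm of `F ≥ 0` in `L_{p⃗}(Q(0, r))`. -/
def cubeNorm {n : ℕ} (p : Fin n → ℝ) (F : EuclideanSpace ℝ (Fin n) → ℝ≥0∞) (r : ℝ) : ℝ≥0∞ :=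
  mixedNorm n p (fun x => (cube n r).indicator F (WithLp.toLp 2 x))

/-- The norm `‖v g‖_{L_θ(0,∞)}` of `g ≥ 0` in the weighted space `L_{θ,v}(0,∞)`. -/
def weightedNorm (θ : ℝ≥0∞) (v : ℝ → ℝ) (g : ℝ → ℝ≥0∞) : ℝ≥0∞ :=
  eLpNorm (fun r => ‖v r‖ₑ * g r) θ (volume.restrict (Ioi 0))

/-- The local mixed Morrey-type quasi-norm `‖ w(r) ‖F‖_{L_{p⃗}(Q(0,r))} ‖_{L_θ(0,∞)}` of `F ≥ 0`.
For a real or complex function `f` it is taken at `F = |f|`. -/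
def lmNorm {n : ℕ} (p : Fin n → ℝ) (θ : ℝ≥0∞) (w : ℝ → ℝ)
    (F : EuclideanSpace ℝ (Fin n) → ℝ≥0∞) : ℝ≥0∞ :=
  weightedNorm θ w (cubeNorm p F)

/-- The Hardy–Littlewood maximal function of `F ≥ 0`: the supremum of the averages of `F` over all
open balls that contain `x`. For a real or complex function `f` it is taken at `F = |f|`. -/
def maximal {n : ℕ} (F : EuclideanSpace ℝ (Fin n) → ℝ≥0∞) (x : EuclideanSpace ℝ (Fin n)) : ℝ≥0∞ :=
  ⨆ (c : EuclideanSpace ℝ (Fin n)) (ρ : ℝ) (_ : x ∈ Metric.ball c ρ),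
    (∫⁻ y in Metric.ball c ρ, F y) / volume (Metric.ball c ρ)

/-- The dual Hardy operator `H* g(r) = ∫_r^∞ g(t) dt` on functions `g ≥ 0`. -/
def hardyDual (g : ℝ → ℝ≥0∞) (r : ℝ) : ℝ≥0∞ :=
  ∫⁻ t in Ioi r, g t

/-- `H*` is bounded from `L_{θ,v₁}(0,∞)` to `L_{θ,v₂}(0,∞)`. Since `|H* g| ≤ H* |g|`, with equality
for `g ≥ 0`, the boundedness of this positive operator is tested on non-negative functions. -/
def HardyDualBounded (θ : ℝ≥0∞) (v₁ v₂ : ℝ → ℝ) : Prop :=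
  ∃ C : ℝ≥0, ∀ g : ℝ → ℝ≥0∞, Measurable g →
    weightedNorm θ v₂ (hardyDual g) ≤ C * weightedNorm θ v₁ g

end LocalMixedMorrey

end

/-! Write σ = ∑ 1/p_i and S = (∑ |f_j|^v)^(1/v). Everything rests on a local estimate
(`cubeNorm_seqNorm_maximal_le`): the mixed norm of (∑ (M f_j)^v)^(1/v) over Q(0,r) is at most C r^σ
H*g(r), where g(t) = t^(-σ-1) ‖S‖_{L_p(Q(0,t))}. The hypothesis on H* then finishes the proof,
because the second weight is r^σ w and the first weight times g is exactly w(r) ‖S‖_{L_p(Q(0,r))}.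
The scalar inequality is the case of a sequence with one nonzero term, and the inequality for the
supremum is the scalar one applied to sup |f_j|.

For the local estimate each f_j is cut at Q(0,2r). A ball that meets Q(0,r) and leaves Q(0,2r) has
radius greater than r/2, so on Q(0,r) the far parts contribute at most one constant, an integral of
t^(-n-1) ∫_{Q(0,t)} S over t > 2r. Minkowski's inequality in ℓ^v and Hölder's inequality on cubes
turn it into H*g(r). The near parts need a Fefferman–Stein inequality in mixed norms on all of ℝ^n
(`exists_mixedNorm_tsum_iterMax_le`); the norm of S over Q(0,2r) is then below r^σ H*g(r) because
cube norms increase with the radius.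

For Fefferman–Stein, M is dominated by the composition of the one-dimensional maximal operators in
the coordinates. These have to be bounded on functions with values in ℓ^v and in iterated Lebesgue
spaces. The class `MaximalBounded` asks for such a bound on L^p(w) for all p > 1 and all A_p
weights, and it is stable under taking a further L^q norm: for p = q by Tonelli, for other p by
Rubio de Francia extrapolation. The scalar case is Muckenhoupt's theorem. It follows from the
maximal theorem for an arbitrary s-finite measure on the line, where a covering lemma with overlap
two makes any doubling condition superfluous. -/

namespace LocalMixedMorrey

/-! ### The one-dimensional maximal operator of an arbitrary measure -/

/-- The open interval with rational endpoints `I.1` and `I.2`. -/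
def ratIoo (I : ℚ × ℚ) : Set ℝ := Ioo (I.1 : ℝ) I.2

theorem measurableSet_ratIoo (I : ℚ × ℚ) : MeasurableSet (ratIoo I) := measurableSet_Ioo

/-- To the left of the common point `x` the interval `K` lies in `I`, to the right in `J`. Among
three intervals through one point, one is therefore redundant. -/
theorem ratIoo_subset_union_of_mem {I J K : ℚ × ℚ} {x : ℝ} (hI : x ∈ ratIoo I) (hJ : x ∈ ratIoo J)
    (h1 : I.1 ≤ K.1) (h2 : K.2 ≤ J.2) : ratIoo K ⊆ ratIoo I ∪ ratIoo J := by
  intro y hy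
  simp only [ratIoo, mem_Ioo, mem_union] at *
  have h1' : (I.1 : ℝ) ≤ K.1 := by exact_mod_cast h1
  have h2' : (K.2 : ℝ) ≤ J.2 := by exact_mod_cast h2
  rcases le_total y x with h | h
  · left; constructor <;> linarith
  · right; constructor <;> linarith

/-- Every finite family of intervals has a subfamily with the same union in which no point is
covered more than twice. -/
theorem exists_subfamily_card_le_two (T : Finset (ℚ × ℚ)) :
    ∃ S ⊆ T, (⋃ I ∈ S, ratIoo I) = ⋃ I ∈ T, ratIoo I ∧
      ∀ x, ∑ I ∈ S, (ratIoo I).indicator (1 : ℝ → ℝ≥0∞) x ≤ 2 := by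
  classical
  have hne : (T.powerset.filter fun S => (⋃ I ∈ S, ratIoo I) = ⋃ I ∈ T, ratIoo I).Nonempty :=
    ⟨T, by simp⟩
  -- Take `S` of least cardinality. If three members contained `x`, the one reaching furthest left
  -- and the one reaching furthest right would cover a third, which could be discarded.
  obtain ⟨S, hS, hmin⟩ := Finset.exists_min_image _ Finset.card hne
  rw [Finset.mem_filter, Finset.mem_powerset] at hS
  refine ⟨S, hS.1, hS.2, fun x => ?_⟩
  have hsum : ∑ I ∈ S, (ratIoo I).indicator (1 : ℝ → ℝ≥0∞) x
      = ((S.filter fun I => x ∈ ratIoo I).card : ℝ≥0∞) := by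
    rw [Finset.card_filter]
    push_cast
    exact Finset.sum_congr rfl fun I _ => by simp [indicator_apply]
  rw [hsum]
  by_contra hcon
  have hcard : 2 < (S.filter fun I => x ∈ ratIoo I).card := by
    rw [not_le] at hcon
    exact_mod_cast hcon
  have hne' : (S.filter fun I => x ∈ ratIoo I).Nonempty := Finset.card_pos.mp (by omega)
  obtain ⟨I, hI, hImin⟩ := Finset.exists_min_image _ (fun I : ℚ × ℚ => I.1) hne'
  obtain ⟨J, hJ, hJmax⟩ := Finset.exists_max_image _ (fun I : ℚ × ℚ => I.2) hne'
  obtain ⟨K, hK, hKIJ⟩ : ∃ K ∈ S.filter fun I => x ∈ ratIoo I, K ∉ ({I, J} : Finset (ℚ × ℚ)) :=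
    Finset.exists_mem_notMem_of_card_lt_card (lt_of_le_of_lt Finset.card_le_two hcard)
  simp only [Finset.mem_insert, Finset.mem_singleton, not_or] at hKIJ
  have hsub := ratIoo_subset_union_of_mem (Finset.mem_filter.mp hI).2 (Finset.mem_filter.mp hJ).2
    (hImin K hK) (hJmax K hK)
  have hKS := (Finset.mem_filter.mp hK).1
  have := hmin (S.erase K) (by
    rw [Finset.mem_filter, Finset.mem_powerset]
    refine ⟨(Finset.erase_subset _ _).trans hS.1, ?_⟩
    rw [← hS.2]
    refine Subset.antisymm (biUnion_subset_biUnion_left fun L hL => Finset.mem_of_mem_erase hL) ?_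
    refine iUnion₂_subset fun L hL => ?_
    by_cases hLK : L = K
    · subst hLK
      refine hsub.trans (union_subset ?_ ?_)
      · exact subset_biUnion_of_mem (u := ratIoo) (s := {L' | L' ∈ S.erase L})
          (Finset.mem_erase.mpr ⟨fun h => hKIJ.1 h.symm, (Finset.mem_filter.mp hI).1⟩)
      · exact subset_biUnion_of_mem (u := ratIoo) (s := {L' | L' ∈ S.erase L})
          (Finset.mem_erase.mpr ⟨fun h => hKIJ.2 h.symm, (Finset.mem_filter.mp hJ).1⟩)
    · exact subset_biUnion_of_mem (u := ratIoo) (s := {L' | L' ∈ S.erase K})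
        (Finset.mem_erase.mpr ⟨hLK, hL⟩))
  rw [Finset.card_erase_of_mem hKS] at this
  have := Finset.card_pos.mpr ⟨K, hKS⟩
  omega

/-- The uncentred maximal function of `f` with respect to the measure `μ` on the line. Only
intervals with rational endpoints are used, which makes measurability a triviality. -/
noncomputable def avgMax (μ : Measure ℝ) (f : ℝ → ℝ≥0∞) (x : ℝ) : ℝ≥0∞ :=
  ⨆ I : ℚ × ℚ, (ratIoo I).indicator (fun _ => (∫⁻ t in ratIoo I, f t ∂μ) / μ (ratIoo I)) x

section avgMax

variable {μ : Measure ℝ} {f g : ℝ → ℝ≥0∞}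

theorem average_le_avgMax {I : ℚ × ℚ} {x : ℝ} (hx : x ∈ ratIoo I) :
    (∫⁻ t in ratIoo I, f t ∂μ) / μ (ratIoo I) ≤ avgMax μ f x := by
  refine le_trans ?_ (le_iSup _ I)
  rw [indicator_of_mem hx]

theorem avgMax_le_iff {x : ℝ} {c : ℝ≥0∞} :
    avgMax μ f x ≤ c ↔ ∀ I, x ∈ ratIoo I → (∫⁻ t in ratIoo I, f t ∂μ) / μ (ratIoo I) ≤ c := by
  rw [avgMax, iSup_le_iff]
  refine forall_congr' fun I => ?_
  by_cases hx : x ∈ ratIoo I <;> simp [hx]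

theorem measurable_avgMax : Measurable (avgMax μ f) :=
  Measurable.iSup fun I => measurable_const.indicator (measurableSet_ratIoo I)

theorem measurable_avgMax_uncurry {α : Type*} [MeasurableSpace α] [SFinite μ] {F : α → ℝ → ℝ≥0∞}
    (hF : Measurable (Function.uncurry F)) :
    Measurable (fun z : α × ℝ => avgMax μ (F z.1) z.2) := by
  refine Measurable.iSup fun I => ?_
  have h1 : Measurable fun z : α × ℝ =>
      (∫⁻ t in ratIoo I, F z.1 t ∂μ) / μ (ratIoo I) :=
    ((hF.lintegral_prod_right (ν := μ.restrict (ratIoo I))).comp measurable_fst).div_const _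
  exact h1.indicator (measurable_snd (measurableSet_ratIoo I))

theorem avgMax_tsum_le {F : ℕ → ℝ → ℝ≥0∞} (hF : ∀ k, Measurable (F k)) (x : ℝ) :
    avgMax μ (fun t => ∑' k, F k t) x ≤ ∑' k, avgMax μ (F k) x := by
  rw [avgMax_le_iff]
  intro I hI
  rw [lintegral_tsum fun k => (hF k).aemeasurable, div_eq_mul_inv, ← ENNReal.tsum_mul_right]
  exact ENNReal.tsum_le_tsum fun k => average_le_avgMax hI

theorem avgMax_const_mul (hf : Measurable f) (c : ℝ≥0∞) (x : ℝ) :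
    avgMax μ (fun t => c * f t) x = c * avgMax μ f x := by
  rw [avgMax, avgMax, ENNReal.mul_iSup]
  refine iSup_congr fun I => ?_
  rw [lintegral_const_mul _ hf]
  by_cases hx : x ∈ ratIoo I <;> simp [hx, mul_div_assoc]

/-- The weak type `(1, 1)` inequality, for an arbitrary measure on the line. -/
theorem mul_measure_lt_avgMax_le (hf : Measurable f) (c : ℝ≥0∞) :
    c * μ {x | c < avgMax μ f x} ≤ 2 * ∫⁻ x, f x ∂μ := by
  classical
  let S : Set (ℚ × ℚ) := {I | c < (∫⁻ t in ratIoo I, f t ∂μ) / μ (ratIoo I)}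
  -- The level set is a directed union over finite families of intervals with average above `c`, so
  -- continuity from below reduces the claim to finite families.
  have hset : {x | c < avgMax μ f x} = ⋃ T : Finset S, ⋃ I ∈ T.map (.subtype _), ratIoo I := by
    ext x
    have : c < avgMax μ f x ↔ ∃ I ∈ S, x ∈ ratIoo I := by
      rw [← not_le, avgMax_le_iff]
      push Not
      exact exists_congr fun I => and_comm
    simp only [mem_ofPred_eq, this, mem_iUnion]
    constructor
    · rintro ⟨I, hI, hx⟩
      exact ⟨{⟨I, hI⟩}, I, by simp, hx⟩
    · rintro ⟨T, I, hI, hx⟩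
      obtain ⟨J, -, rfl⟩ := Finset.mem_map.mp hI
      exact ⟨J, J.2, hx⟩
  have hdir : Directed (· ⊆ ·) fun T : Finset S => ⋃ I ∈ T.map (.subtype _), ratIoo I := by
    refine Monotone.directed_le fun T T' h => ?_
    exact biUnion_subset_biUnion_left fun I hI => Finset.map_subset_map.mpr h hI
  rw [hset, hdir.measure_iUnion, ENNReal.mul_iSup]
  refine iSup_le fun T => ?_
  -- Overlap at most two takes the place of Vitali's enlarged intervals, whose measure could not be
  -- controlled for a general `μ`.
  obtain ⟨U, hU, hUT, hover⟩ := exists_subfamily_card_le_two (T.map (.subtype _))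
  rw [← hUT]
  have hUS : ∀ I ∈ U, I ∈ S := fun I hI => by
    obtain ⟨J, -, rfl⟩ := Finset.mem_map.mp (hU hI)
    exact J.2
  calc c * μ (⋃ I ∈ U, ratIoo I) ≤ c * ∑ I ∈ U, μ (ratIoo I) := by
        gcongr
        exact measure_biUnion_finset_le _ _
    _ = ∑ I ∈ U, c * μ (ratIoo I) := Finset.mul_sum _ _ _
    _ ≤ ∑ I ∈ U, ∫⁻ t, (ratIoo I).indicator 1 t * f t ∂μ := by
        refine Finset.sum_le_sum fun I hI => ?_
        have h1 : ∫⁻ t, (ratIoo I).indicator 1 t * f t ∂μ = ∫⁻ t in ratIoo I, f t ∂μ := by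
          rw [← lintegral_indicator (measurableSet_ratIoo I)]
          refine lintegral_congr fun t => ?_
          by_cases ht : t ∈ ratIoo I <;> simp [ht]
        rw [h1]
        exact ENNReal.mul_le_of_le_div (hUS I hI).le
    _ = ∫⁻ t, (∑ I ∈ U, (ratIoo I).indicator 1 t) * f t ∂μ := by
        rw [← lintegral_finsetSum]
        · exact lintegral_congr fun t => by rw [Finset.sum_mul]
        · exact fun I _ => (measurable_one.indicator (measurableSet_ratIoo I)).mul hf
    _ ≤ ∫⁻ t, 2 * f t ∂μ := lintegral_mono fun t => by gcongr; exact hover t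
    _ = 2 * ∫⁻ x, f x ∂μ := lintegral_const_mul _ hf

/-- The layer-cake formula for a single number, a^q = ∫_0^a q t^(q-1) dt. The value `∞` is included
because a maximal function may be infinite. -/
theorem lintegral_indicator_lt_rpow {q : ℝ} (hq : 0 < q) (a : ℝ≥0∞) :
    ∫⁻ t in Ioi (0 : ℝ), {t : ℝ | ENNReal.ofReal t < a}.indicator
      (fun t => ENNReal.ofReal q * ENNReal.ofReal (t ^ (q - 1))) t = a ^ q := by
  have hfin : ∀ b : ℝ, 0 ≤ b → ∫⁻ t in Ioi (0 : ℝ), {t : ℝ | t < b}.indicator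
      (fun t => ENNReal.ofReal q * ENNReal.ofReal (t ^ (q - 1))) t = ENNReal.ofReal b ^ q := by
    intro b hb
    -- Layer-cake for a constant function on a one-point probability space.
    have h := lintegral_rpow_eq_lintegral_meas_lt_mul (Measure.dirac ()) (f := fun _ => b)
      (Filter.Eventually.of_forall fun _ => hb) aemeasurable_const hq
    rw [ENNReal.ofReal_rpow_of_nonneg hb hq.le]
    rw [lintegral_const, measure_univ, mul_one] at h
    rw [h, ← lintegral_const_mul' _ _ ENNReal.ofReal_ne_top]
    refine lintegral_congr fun t => ?_
    by_cases ht : t < b <;> simp [ht]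
  have hset : ∀ b : ℝ≥0, ∫⁻ t in Ioi (0 : ℝ), {t : ℝ | ENNReal.ofReal t < b}.indicator
      (fun t => ENNReal.ofReal q * ENNReal.ofReal (t ^ (q - 1))) t = (b : ℝ≥0∞) ^ q := by
    intro b
    rw [← ENNReal.ofReal_coe_nnreal, ← hfin b b.2]
    refine setLIntegral_congr_fun measurableSet_Ioi fun t ht => ?_
    have : ENNReal.ofReal t < ENNReal.ofReal b ↔ t < b :=
      ENNReal.ofReal_lt_ofReal_iff_of_nonneg (le_of_lt ht)
    rw [ENNReal.ofReal_coe_nnreal] at this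
    simp [indicator_apply, this]
  induction a with
  | coe b => exact hset b
  | top =>
    rw [ENNReal.top_rpow_of_pos hq]
    refine ENNReal.eq_top_of_forall_nnreal_le fun r => ?_
    have h1 : ((r ^ (1 / q) : ℝ≥0) : ℝ≥0∞) ^ q = r := by
      rw [← ENNReal.coe_rpow_of_nonneg _ hq.le, ← NNReal.rpow_mul, one_div_mul_cancel hq.ne',
        NNReal.rpow_one]
    rw [← h1, ← hset]
    refine lintegral_mono fun t => indicator_le_indicator_of_subset ?_ (fun _ => zero_le) t
    intro t ht
    simp

/-- The Hardy–Littlewood–Marcinkiewicz theorem, for an arbitrary `s`-finite measure on the line. -/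
theorem lintegral_avgMax_rpow_le {p : ℝ} (hp : 1 < p) : ∃ C : ℝ≥0, ∀ (μ : Measure ℝ) [SFinite μ]
    (f : ℝ → ℝ≥0∞), Measurable f → ∫⁻ x, avgMax μ f x ^ p ∂μ ≤ C * ∫⁻ x, f x ^ p ∂μ := by
  have hp0 : 0 < p := by linarith
  have hp1 : 0 < p - 1 := by linarith
  -- The 4 is the weak-type constant 2 times another 2 for working at level t/2; the rest is
  -- ∫_0^{2f} p t^(p-2) dt = p/(p-1) (2f)^(p-1). Nothing depends on `μ`.
  refine ⟨(4 * (p / (p - 1)) * 2 ^ (p - 1)).toNNReal, fun μ _ f hf => ?_⟩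
  have hM : Measurable (avgMax μ f) := measurable_avgMax
  set r : ℝ → ℝ≥0∞ := fun t => ENNReal.ofReal p * ENNReal.ofReal (t ^ (p - 1)) with hr
  have hrm : Measurable r := by fun_prop
  -- Marcinkiewicz truncation: `f' t` keeps `f` where it exceeds t/2. The remainder adds at most t/2
  -- to any average, so `M f > t` forces `M (f' t) > t/2`.
  set f' : ℝ → ℝ → ℝ≥0∞ := fun t x => {x | ENNReal.ofReal t < 2 * f x}.indicator f x with hf'
  have hset2 : MeasurableSet {z : ℝ × ℝ | ENNReal.ofReal z.1 < 2 * f z.2} :=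
    measurableSet_lt (by fun_prop) (by fun_prop)
  have hlevel : ∀ t : ℝ, 0 < t → μ {x | ENNReal.ofReal t < avgMax μ f x} ≤
      (4 * ENNReal.ofReal t⁻¹) * ∫⁻ x, f' t x ∂μ := by
    intro t ht
    have hft : Measurable (f' t) :=
      hf.indicator (measurableSet_lt measurable_const (by fun_prop))
    have hsub : {x | ENNReal.ofReal t < avgMax μ f x} ⊆
        {x | ENNReal.ofReal (t / 2) < avgMax μ (f' t) x} := by
      intro x hx
      simp only [mem_ofPred_eq] at hx ⊢
      by_contra hcon
      rw [not_lt, avgMax_le_iff] at hcon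
      refine absurd hx (not_lt.mpr (avgMax_le_iff.mpr fun I hI => ?_))
      have h1 : ∀ y, f y ≤ f' t y + ENNReal.ofReal (t / 2) := by
        intro y
        by_cases hy : ENNReal.ofReal t < 2 * f y
        · simp [hf', hy]
        · simp only [hf', mem_ofPred_eq, hy, not_false_eq_true, indicator_of_notMem, zero_add]
          rw [not_lt] at hy
          rw [ENNReal.ofReal_div_of_pos two_pos, ENNReal.ofReal_ofNat,
            ENNReal.le_div_iff_mul_le (by simp) (by simp), mul_comm]
          exact hy
      calc (∫⁻ y in ratIoo I, f y ∂μ) / μ (ratIoo I)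
          ≤ (∫⁻ y in ratIoo I, (f' t y + ENNReal.ofReal (t / 2)) ∂μ) / μ (ratIoo I) := by
            gcongr; exact h1 _
        _ = (∫⁻ y in ratIoo I, f' t y ∂μ) / μ (ratIoo I)
            + ENNReal.ofReal (t / 2) * (μ (ratIoo I) / μ (ratIoo I)) := by
            rw [lintegral_add_left hft, lintegral_const, ENNReal.add_div,
              Measure.restrict_apply_univ, mul_div_assoc]
        _ ≤ ENNReal.ofReal (t / 2) + ENNReal.ofReal (t / 2) * 1 := by
            gcongr
            · exact hcon I hI
            -- Only an inequality, since `μ` of the interval may be 0 or `∞`.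
            · exact ENNReal.div_self_le_one
        _ = ENNReal.ofReal t := by
            rw [mul_one, ← ENNReal.ofReal_add (by linarith) (by linarith), add_halves]
    have hw := mul_measure_lt_avgMax_le (μ := μ) hft (ENNReal.ofReal (t / 2))
    have hcancel : ENNReal.ofReal (2 * t⁻¹) * ENNReal.ofReal (t / 2) = 1 := by
      rw [← ENNReal.ofReal_mul (by positivity)]
      have : 2 * t⁻¹ * (t / 2) = 1 := by field_simp
      rw [this, ENNReal.ofReal_one]
    calc μ {x | ENNReal.ofReal t < avgMax μ f x}
        ≤ μ {x | ENNReal.ofReal (t / 2) < avgMax μ (f' t) x} := measure_mono hsub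
      _ = ENNReal.ofReal (2 * t⁻¹) * (ENNReal.ofReal (t / 2) *
          μ {x | ENNReal.ofReal (t / 2) < avgMax μ (f' t) x}) := by
          rw [← mul_assoc, hcancel, one_mul]
      _ ≤ ENNReal.ofReal (2 * t⁻¹) * (2 * ∫⁻ x, f' t x ∂μ) := by gcongr
      _ = (4 * ENNReal.ofReal t⁻¹) * ∫⁻ x, f' t x ∂μ := by
          rw [ENNReal.ofReal_mul two_pos.le, ENNReal.ofReal_ofNat]
          ring
  calc ∫⁻ x, avgMax μ f x ^ p ∂μ
      = ∫⁻ x, (∫⁻ t in Ioi (0 : ℝ),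
          {t : ℝ | ENNReal.ofReal t < avgMax μ f x}.indicator r t) ∂μ := by
        simp_rw [hr, lintegral_indicator_lt_rpow hp0]
    _ = ∫⁻ t in Ioi (0 : ℝ), ∫⁻ x,
          {t : ℝ | ENNReal.ofReal t < avgMax μ f x}.indicator r t ∂μ := by
        refine lintegral_lintegral_swap (Measurable.aemeasurable ?_)
        exact (hrm.comp measurable_snd).indicator
          (s := {z : ℝ × ℝ | ENNReal.ofReal z.2 < avgMax μ f z.1})
          (measurableSet_lt (by fun_prop) (by fun_prop))
    _ = ∫⁻ t in Ioi (0 : ℝ), r t * μ {x | ENNReal.ofReal t < avgMax μ f x} := by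
        refine lintegral_congr fun t => ?_
        rw [← lintegral_indicator_const (measurableSet_lt measurable_const hM)]
        rfl
    _ ≤ ∫⁻ t in Ioi (0 : ℝ), ∫⁻ x, r t * ((4 * ENNReal.ofReal t⁻¹) * f' t x) ∂μ := by
        refine setLIntegral_mono' measurableSet_Ioi fun t ht => ?_
        have hft : Measurable (f' t) :=
          hf.indicator (measurableSet_lt measurable_const (by fun_prop))
        rw [lintegral_const_mul _ (hft.const_mul _), lintegral_const_mul _ hft]
        gcongr
        exact hlevel t ht
    _ = ∫⁻ x, (∫⁻ t in Ioi (0 : ℝ), r t * ((4 * ENNReal.ofReal t⁻¹) * f' t x)) ∂μ := by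
        refine lintegral_lintegral_swap (Measurable.aemeasurable ?_)
        have : Measurable (Function.uncurry f') := (hf.comp measurable_snd).indicator hset2
        have h4 : Measurable fun z : ℝ × ℝ => r z.1 * (4 * ENNReal.ofReal z.1⁻¹) := by fun_prop
        convert h4.mul this using 1
        funext z
        simp only [Function.uncurry_def, Pi.mul_apply, mul_assoc]
    _ = ∫⁻ x, (4 * ENNReal.ofReal (p / (p - 1))) * f x * (2 * f x) ^ (p - 1) ∂μ := by
        refine lintegral_congr fun x => ?_
        rw [← lintegral_indicator_lt_rpow hp1 (2 * f x), ← lintegral_const_mul _ (Measurable.indicator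
          (by fun_prop) (measurableSet_lt (by fun_prop) measurable_const))]
        refine setLIntegral_congr_fun measurableSet_Ioi fun t ht => ?_
        by_cases hx : ENNReal.ofReal t < 2 * f x
        · simp only [hr, hf', mem_ofPred_eq, hx, indicator_of_mem]
          have h1 : ENNReal.ofReal (t ^ (p - 1 - 1)) =
              ENNReal.ofReal (t ^ (p - 1)) * ENNReal.ofReal t⁻¹ := by
            rw [← ENNReal.ofReal_mul (Real.rpow_nonneg (le_of_lt ht) _),
              Real.rpow_sub_one (ne_of_gt ht), div_eq_mul_inv]
          have h2 : ENNReal.ofReal (p / (p - 1)) * ENNReal.ofReal (p - 1) = ENNReal.ofReal p := by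
            rw [← ENNReal.ofReal_mul (by positivity), div_mul_cancel₀ _ hp1.ne']
          rw [h1, ← h2]
          ring
        · simp [hf', hx]
    _ = ((4 * (p / (p - 1)) * 2 ^ (p - 1)).toNNReal : ℝ≥0) * ∫⁻ x, f x ^ p ∂μ := by
        rw [← lintegral_const_mul _ (hf.pow_const p)]
        refine lintegral_congr fun x => ?_
        have h1 : f x ^ p = f x * f x ^ (p - 1) := by
          nth_rw 2 [← ENNReal.rpow_one (f x)]
          rw [← ENNReal.rpow_add_of_nonneg _ _ zero_le_one hp1.le, add_sub_cancel]
        have h2 : (((4 * (p / (p - 1)) * 2 ^ (p - 1)).toNNReal : ℝ≥0) : ℝ≥0∞) =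
            4 * ENNReal.ofReal (p / (p - 1)) * 2 ^ (p - 1) := by
          rw [← ENNReal.ofReal, ENNReal.ofReal_mul (by positivity), ENNReal.ofReal_mul (by positivity),
            ENNReal.ofReal_ofNat, ← ENNReal.ofReal_rpow_of_pos two_pos, ENNReal.ofReal_ofNat]
        rw [h1, h2, ENNReal.mul_rpow_of_nonneg _ _ hp1.le]
        ring

end avgMax

/-! ### Truncation and Minkowski's integral inequality -/

/-- To bound `∫ g ^ p`, one may assume that the integral is finite. -/
theorem lintegral_rpow_le_of_forall_le {X : Type*} [MeasurableSpace X] {μ : Measure X}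
    [SigmaFinite μ] {p : ℝ} (hp : 0 < p) {g : X → ℝ≥0∞} (hg : Measurable g) {D : ℝ≥0∞}
    (h : ∀ g' : X → ℝ≥0∞, Measurable g' → (∀ x, g' x ≤ g x) → ∫⁻ x, g' x ^ p ∂μ ≠ ∞ →
      ∫⁻ x, g' x ^ p ∂μ ≤ D) :
    ∫⁻ x, g x ^ p ∂μ ≤ D := by
  -- Cut off at height `N` and restricted to a set of finite measure, `g` has a finite integral;
  -- monotone convergence recovers `g`.
  set G : ℕ → X → ℝ≥0∞ := fun N => (spanningSets μ N).indicator fun x => min (g x) N with hG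
  have hGm : ∀ N, Measurable (G N) := fun N =>
    (hg.min measurable_const).indicator (measurableSet_spanningSets μ N)
  have hGmono : ∀ x, Monotone fun N => G N x := by
    intro x N N' hNN
    refine (indicator_le_indicator_of_subset (monotone_spanningSets μ hNN) (fun _ => zero_le)
      x).trans (indicator_le_indicator ?_)
    gcongr
  have hle : ∀ N x, G N x ≤ g x := fun N x => by
    by_cases hx : x ∈ spanningSets μ N <;> simp [hG, hx]
  have hfin : ∀ N, ∫⁻ x, G N x ^ p ∂μ ≠ ∞ := by
    intro N
    have : ∫⁻ x, G N x ^ p ∂μ ≤ ∫⁻ x, (spanningSets μ N).indicator (fun _ => (N : ℝ≥0∞) ^ p) x ∂μ := by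
      refine lintegral_mono fun x => ?_
      by_cases hx : x ∈ spanningSets μ N
      · simp only [hG, hx, indicator_of_mem]
        gcongr
        exact min_le_right _ _
      · simp [hG, hx, hp]
    refine ne_top_of_le_ne_top ?_ this
    rw [lintegral_indicator_const (measurableSet_spanningSets μ N)]
    exact ENNReal.mul_ne_top (by simp [hp.le]) (measure_spanningSets_lt_top μ N).ne
  have hlim : Filter.Tendsto (fun N => ∫⁻ x, G N x ^ p ∂μ) Filter.atTop
      (nhds (∫⁻ x, g x ^ p ∂μ)) := by
    refine lintegral_tendsto_of_tendsto_of_monotone (fun N => ((hGm N).pow_const p).aemeasurable)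
      (Filter.Eventually.of_forall fun x N N' hNN => ?_) (Filter.Eventually.of_forall fun x => ?_)
    · exact ENNReal.rpow_le_rpow (hGmono x hNN) hp.le
    · refine ((ENNReal.continuous_rpow_const (y := p)).tendsto _).comp ?_
      have h1 : Filter.Tendsto (fun N : ℕ => min (g x) N) Filter.atTop (nhds (min (g x) ∞)) :=
        tendsto_const_nhds.min ENNReal.tendsto_nat_nhds_top
      rw [min_top_right] at h1
      refine h1.congr' ?_
      have hx : x ∈ ⋃ N, spanningSets μ N := by rw [iUnion_spanningSets]; trivial
      obtain ⟨N₀, hN₀⟩ := mem_iUnion.mp hx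
      filter_upwards [Filter.eventually_ge_atTop N₀] with N hN
      simp [hG, monotone_spanningSets μ hN hN₀]
  exact le_of_tendsto' hlim fun N => h _ (hGm N) (hle N) (hfin N)

theorem rpow_eq_mul_rpow_sub_one {p : ℝ} (hp : 1 ≤ p) (a : ℝ≥0∞) : a ^ p = a * a ^ (p - 1) := by
  nth_rw 2 [← ENNReal.rpow_one a]
  rw [← ENNReal.rpow_add_of_nonneg _ _ zero_le_one (by linarith), add_sub_cancel]

/-- Absorption: a bound `Y ≤ D Y ^ (1 / q)` with finite `Y` gives `Y ≤ D ^ p`. -/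
theorem le_rpow_of_le_mul_rpow {p q : ℝ} (hpq : p.HolderConjugate q) {Y D : ℝ≥0∞} (hY : Y ≠ ∞)
    (h : Y ≤ D * Y ^ (1 / q)) : Y ≤ D ^ p := by
  rcases eq_or_ne Y 0 with rfl | h0
  · exact zero_le
  have h1 : Y = Y ^ (1 / p) * Y ^ (1 / q) := by
    rw [← ENNReal.rpow_add _ _ h0 hY, one_div, one_div, hpq.inv_add_inv_eq_one, ENNReal.rpow_one]
  have h2 : Y ^ (1 / p) ≤ D := by
    have hne : Y ^ (1 / q) ≠ 0 := by simp [h0, hY]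
    have hnt : Y ^ (1 / q) ≠ ∞ := by simp [h0, hY]
    refine (ENNReal.mul_le_mul_iff_left hne hnt).mp ?_
    rwa [← h1]
  calc Y = (Y ^ (1 / p)) ^ p := by
        rw [← ENNReal.rpow_mul, one_div_mul_cancel hpq.pos.ne', ENNReal.rpow_one]
    _ ≤ D ^ p := ENNReal.rpow_le_rpow h2 hpq.nonneg

/-- Minkowski's integral inequality. -/
theorem lintegral_lintegral_rpow_le {X Y : Type*} [MeasurableSpace X] [MeasurableSpace Y]
    {μ : Measure X} {ν : Measure Y} [SigmaFinite μ] [SFinite ν] {p : ℝ} (hp : 1 < p)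
    {φ : X → Y → ℝ≥0∞} (hφ : Measurable (Function.uncurry φ)) :
    (∫⁻ x, (∫⁻ y, φ x y ∂ν) ^ p ∂μ) ^ (1 / p) ≤ ∫⁻ y, (∫⁻ x, φ x y ^ p ∂μ) ^ (1 / p) ∂ν := by
  have hpq := Real.HolderConjugate.conjExponent hp
  have hp0 : 0 < p := by linarith
  rw [one_div, ENNReal.rpow_inv_le_iff hp0, ← one_div]
  -- For `g` below the inner integral, bound g^p = g^(p-1) g by g^(p-1) ∫ φ, swap the integrals and
  -- apply Hölder in `x`. The power of ∫ g^p that appears on the right is absorbed, which is why `g`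
  -- is first made to have a finite integral.
  refine lintegral_rpow_le_of_forall_le hp0 hφ.lintegral_prod_right fun g hg hle hfin => ?_
  refine le_rpow_of_le_mul_rpow hpq hfin ?_
  have hφy : ∀ y, Measurable fun x => φ x y := fun y => hφ.comp (measurable_id.prodMk measurable_const)
  calc ∫⁻ x, g x ^ p ∂μ ≤ ∫⁻ x, ∫⁻ y, g x ^ (p - 1) * φ x y ∂ν ∂μ := by
        refine lintegral_mono fun x => ?_
        rw [rpow_eq_mul_rpow_sub_one hp.le, mul_comm,
          lintegral_const_mul _ (f := fun y => φ x y)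
            (hφ.comp (measurable_const.prodMk measurable_id))]
        gcongr
        exact hle x
    _ = ∫⁻ y, ∫⁻ x, g x ^ (p - 1) * φ x y ∂μ ∂ν :=
        lintegral_lintegral_swap (((hg.comp measurable_fst).pow_const _).mul hφ).aemeasurable
    _ ≤ ∫⁻ y, (∫⁻ x, φ x y ^ p ∂μ) ^ (1 / p) *
          (∫⁻ x, g x ^ p ∂μ) ^ (1 / p.conjExponent) ∂ν := by
        refine lintegral_mono fun y => ?_
        have h := ENNReal.lintegral_mul_le_Lp_mul_Lq μ hpq (hφy y).aemeasurable
          (hg.pow_const (p - 1)).aemeasurable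
        simp only [Pi.mul_apply, ← ENNReal.rpow_mul, hpq.sub_one_mul_conj] at h
        simpa only [mul_comm] using h
    _ = _ := lintegral_mul_const _ ((Measurable.lintegral_prod_left
        (f := fun x y => φ x y ^ p) (hφ.pow_const p)).pow_const _)

/-! ### Muckenhoupt weights -/

/-- The Muckenhoupt class `A_p`, with the constant `K`, tested on intervals with rational
endpoints. -/
structure MuckenhouptWeight (p : ℝ) (K : ℝ≥0) (w : ℝ → ℝ≥0∞) : Prop where
  measurable : Measurable w
  ae_ne_zero : ∀ᵐ x, w x ≠ 0
  ae_ne_top : ∀ᵐ x, w x ≠ ∞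
  bound : ∀ I : ℚ × ℚ, (∫⁻ x in ratIoo I, w x) * (∫⁻ x in ratIoo I, w x ^ (-(p - 1)⁻¹)) ^ (p - 1)
    ≤ K * volume (ratIoo I) ^ p

theorem volume_ratIoo_ne_top (I : ℚ × ℚ) : volume (ratIoo I) ≠ ∞ := by
  simp [ratIoo]

theorem volume_ratIoo_ne_zero {I : ℚ × ℚ} {x : ℝ} (hx : x ∈ ratIoo I) : volume (ratIoo I) ≠ 0 :=
  (isOpen_Ioo.measure_pos _ ⟨x, hx⟩).ne'

theorem setLIntegral_ratIoo_ne_zero {I : ℚ × ℚ} {x : ℝ} (hx : x ∈ ratIoo I) {f : ℝ → ℝ≥0∞}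
    (hf : Measurable f) (h : ∀ᵐ x, f x ≠ 0) : ∫⁻ x in ratIoo I, f x ≠ 0 := by
  intro h0
  rw [lintegral_eq_zero_iff hf, Filter.EventuallyEq] at h0
  have := (ae_restrict_of_ae h).and h0
  have hfalse : ∀ᵐ x ∂(volume.restrict (ratIoo I)), False := by
    filter_upwards [this] with x hx using hx.1 hx.2
  rw [ae_iff] at hfalse
  simp only [not_false_eq_true, ofPred_true, Measure.restrict_apply_univ] at hfalse
  exact volume_ratIoo_ne_zero hx hfalse

theorem exists_mem_ratIoo_of_ae {I : ℚ × ℚ} {x : ℝ} (hx : x ∈ ratIoo I) {P : ℝ → Prop}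
    (h : ∀ᵐ x, P x) : ∃ y ∈ ratIoo I, P y := by
  by_contra! hcon
  have : ratIoo I ⊆ {y | ¬ P y} := hcon
  exact volume_ratIoo_ne_zero hx (measure_mono_null this (ae_iff.mp h))

theorem muckenhouptWeight_one {p : ℝ} (hp : 1 < p) {K : ℝ≥0} (hK : 1 ≤ K) :
    MuckenhouptWeight p K fun _ => 1 where
  measurable := measurable_const
  ae_ne_zero := by simp
  ae_ne_top := by simp
  bound I := by
    simp only [ENNReal.one_rpow, lintegral_const, Measure.restrict_apply_univ, one_mul]
    rw [← rpow_eq_mul_rpow_sub_one hp.le]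
    exact le_mul_of_one_le_left zero_le (by exact_mod_cast hK)

section weights

variable {p q : ℝ} {K : ℝ≥0} {w : ℝ → ℝ≥0∞}

/-- Raising the A_p condition to the power 1/(p-1) = q-1 exchanges the roles of `w` and its dual
weight. -/
theorem MuckenhouptWeight.dual (hpq : p.HolderConjugate q) (hw : MuckenhouptWeight p K w) :
    MuckenhouptWeight q (K ^ (p - 1)⁻¹) fun x => w x ^ (-(p - 1)⁻¹) where
  measurable := hw.measurable.pow_const _
  ae_ne_zero := by
    filter_upwards [hw.ae_ne_zero, hw.ae_ne_top] with x h0 h1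
    simp [h0, h1]
  ae_ne_top := by
    filter_upwards [hw.ae_ne_zero, hw.ae_ne_top] with x h0 h1
    simp [h0, h1]
  bound I := by
    have hp1 := hpq.sub_one_pos
    have hq1 : q - 1 = (p - 1)⁻¹ := by
      rw [hpq.conjugate_eq]; field_simp; ring
    have h := ENNReal.rpow_le_rpow (hw.bound I) (inv_nonneg.mpr hp1.le)
    have hself : ∀ x, (w x ^ (-(p - 1)⁻¹)) ^ (-(q - 1)⁻¹) = w x := fun x => by
      rw [← ENNReal.rpow_mul, hq1, inv_inv, neg_mul_neg, inv_mul_cancel₀ hp1.ne', ENNReal.rpow_one]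
    have hpe : p * (p - 1)⁻¹ = q := by rw [hpq.conjugate_eq]; field_simp
    rw [ENNReal.mul_rpow_of_nonneg _ _ (inv_nonneg.mpr hp1.le), ← ENNReal.rpow_mul,
      mul_inv_cancel₀ hp1.ne', ENNReal.rpow_one, ENNReal.mul_rpow_of_nonneg _ _
      (inv_nonneg.mpr hp1.le), ← ENNReal.rpow_mul, hpe,
      ← ENNReal.coe_rpow_of_nonneg _ (inv_nonneg.mpr hp1.le)] at h
    simp_rw [hself]
    rwa [hq1, mul_comm]

/-- The dual factor in the A_p product is positive, so an infinite integral of `w` would violate the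
bound. -/
theorem MuckenhouptWeight.setLIntegral_ne_top (hp : 1 < p) (hw : MuckenhouptWeight p K w)
    (I : ℚ × ℚ) : ∫⁻ x in ratIoo I, w x ≠ ∞ := by
  rcases (ratIoo I).eq_empty_or_nonempty with h | ⟨x, hx⟩
  · simp [h]
  intro htop
  have hp1 : 0 < p - 1 := by linarith
  have h0 : ∫⁻ x in ratIoo I, w x ^ (-(p - 1)⁻¹) ≠ 0 := by
    refine setLIntegral_ratIoo_ne_zero hx (hw.measurable.pow_const _) ?_
    filter_upwards [hw.ae_ne_zero, hw.ae_ne_top] with x h0 h1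
    simp [h0, h1]
  have hb := hw.bound I
  rw [htop, ENNReal.top_mul (by simp [h0, hp1.not_gt])] at hb
  have : (K : ℝ≥0∞) * volume (ratIoo I) ^ p ≠ ∞ := ENNReal.mul_ne_top ENNReal.coe_ne_top
    (ENNReal.rpow_ne_top_of_nonneg (by linarith) (volume_ratIoo_ne_top I))
  exact this (top_le_iff.mp hb)

theorem lintegral_withDensity_eq (hw : Measurable w) {f : ℝ → ℝ≥0∞} (hf : Measurable f) :
    ∫⁻ x, f x ∂(volume.withDensity w) = ∫⁻ x, f x * w x := by
  rw [lintegral_withDensity_eq_lintegral_mul _ hw hf]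
  exact lintegral_congr fun x => by simp [mul_comm]

theorem setLIntegral_withDensity_eq (hw : Measurable w) {f : ℝ → ℝ≥0∞} (hf : Measurable f)
    (I : ℚ × ℚ) :
    ∫⁻ x in ratIoo I, f x ∂(volume.withDensity w) = ∫⁻ x in ratIoo I, f x * w x := by
  rw [setLIntegral_withDensity_eq_setLIntegral_mul _ hw hf (measurableSet_ratIoo I)]
  exact lintegral_congr fun x => by simp [mul_comm]

/-- **Muckenhoupt's theorem**: the maximal operator is bounded on `L^p(w)` for weights `w` of class
`A_p`. The proof dominates `(M f) ^ (p - 1)` by `M_w (M_σ (f / σ) ^ (p - 1) / w)`. -/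
theorem lintegral_avgMax_rpow_mul_le (hp : 1 < p) (K : ℝ≥0) : ∃ C : ℝ≥0, ∀ w : ℝ → ℝ≥0∞,
    MuckenhouptWeight p K w → ∀ f : ℝ → ℝ≥0∞, Measurable f →
      ∫⁻ x, avgMax volume f x ^ p * w x ≤ C * ∫⁻ x, f x ^ p * w x := by
  have hpq := Real.HolderConjugate.conjExponent hp
  set q := p.conjExponent
  have hp1 : 0 < p - 1 := by linarith
  have hq1 : q = 1 + (p - 1)⁻¹ := by rw [hpq.conjugate_eq]; field_simp; ring
  -- `C₁` and `C₂` serve all measures at once, so the final constant depends on the weight only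
  -- through `K`.
  obtain ⟨C₁, hC₁⟩ := lintegral_avgMax_rpow_le hp
  obtain ⟨C₂, hC₂⟩ := lintegral_avgMax_rpow_le hpq.symm.lt
  refine ⟨K ^ q * (C₂ * C₁), fun w hw f hf => ?_⟩
  have hσ := hw.dual hpq
  set s : ℝ := (p - 1)⁻¹ with hs
  set σ : ℝ → ℝ≥0∞ := fun x => w x ^ (-s) with hσdef
  set m : ℝ → ℝ≥0∞ := avgMax (volume.withDensity σ) fun x => f x * w x ^ s
  have hmm : Measurable m := measurable_avgMax
  have hwm := hw.measurable
  have hfw : Measurable fun x => f x * w x ^ s := hf.mul (hwm.pow_const s)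
  have hmw : Measurable fun x => m x ^ (p - 1) * (w x)⁻¹ := (hmm.pow_const _).mul hwm.inv
  set Z : ℝ → ℝ≥0∞ := avgMax (volume.withDensity w) fun x => m x ^ (p - 1) * (w x)⁻¹
  -- With L, W, S the Lebesgue, w- and σ-measures of the interval and A = a/S the σ-average of f/σ,
  -- one has (a/L)^(p-1) = (A^(p-1) L/W) (W S^(p-1)/L^p). The second factor is at most `K`. As A ≤ m
  -- on the interval, the first is at most the w-average of m^(p-1)/w there, hence at most `Z x`.
  have hpt : ∀ x, avgMax volume f x ≤ (K * Z x) ^ s := by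
    refine fun x => avgMax_le_iff.mpr fun I hI => ?_
    set L := volume (ratIoo I)
    have hL0 : L ≠ 0 := volume_ratIoo_ne_zero hI
    have hLt : L ≠ ∞ := volume_ratIoo_ne_top I
    have hW0 := setLIntegral_ratIoo_ne_zero hI hwm hw.ae_ne_zero
    have hWt := hw.setLIntegral_ne_top hp I
    have hS0 := setLIntegral_ratIoo_ne_zero hI hσ.measurable hσ.ae_ne_zero
    have hSt := hσ.setLIntegral_ne_top hpq.symm.lt I
    have hb := hw.bound I
    set W := ∫⁻ x in ratIoo I, w x
    set S := ∫⁻ x in ratIoo I, w x ^ (-s)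
    set a := ∫⁻ t in ratIoo I, f t
    have ha : a = ∫⁻ t in ratIoo I, f t * w t ^ s ∂(volume.withDensity σ) := by
      rw [setLIntegral_withDensity_eq hσ.measurable hfw]
      refine lintegral_congr_ae (ae_restrict_of_ae ?_)
      filter_upwards [hw.ae_ne_zero, hw.ae_ne_top] with t h0 h1
      rw [hσdef, mul_assoc, ← ENNReal.rpow_add _ _ h0 h1, add_neg_cancel, ENNReal.rpow_zero, mul_one]
    have hvS : volume.withDensity σ (ratIoo I) = S := withDensity_apply _ (measurableSet_ratIoo I)
    have hvW : volume.withDensity w (ratIoo I) = W := withDensity_apply _ (measurableSet_ratIoo I)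
    set A := a / S
    have hA : ∀ y ∈ ratIoo I, A ≤ m y := fun y hy => by
      have := average_le_avgMax (μ := volume.withDensity σ) (f := fun x => f x * w x ^ s) hy
      rwa [← ha, hvS] at this
    have hAZ : A ^ (p - 1) * L / W ≤ Z x := by
      refine le_trans ?_ (average_le_avgMax hI)
      rw [hvW]
      gcongr
      rw [setLIntegral_withDensity_eq hwm hmw]
      calc A ^ (p - 1) * L = ∫⁻ y in ratIoo I, A ^ (p - 1) := by
            rw [setLIntegral_const]
        _ ≤ ∫⁻ y in ratIoo I, m y ^ (p - 1) :=
            setLIntegral_mono' (measurableSet_ratIoo I) fun y hy =>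
              ENNReal.rpow_le_rpow (hA y hy) hp1.le
        _ = _ := by
            refine lintegral_congr_ae (ae_restrict_of_ae ?_)
            filter_upwards [hw.ae_ne_zero, hw.ae_ne_top] with t h0 h1
            rw [mul_assoc, ENNReal.inv_mul_cancel h0 h1, mul_one]
    rw [← ENNReal.rpow_inv_le_iff (inv_pos.mpr hp1), inv_inv]
    have haA : a = A * S := (ENNReal.div_mul_cancel hS0 hSt).symm
    calc (a / L) ^ (p - 1) = A ^ (p - 1) * S ^ (p - 1) * (L ^ (p - 1))⁻¹ := by
          rw [haA, ENNReal.div_rpow_of_nonneg _ _ hp1.le, ENNReal.mul_rpow_of_nonneg _ _ hp1.le,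
            div_eq_mul_inv]
      _ = (A ^ (p - 1) * L / W) * (W * S ^ (p - 1)) * (L ^ p)⁻¹ := by
          have h1 : (L ^ (p - 1))⁻¹ = L * (L ^ p)⁻¹ := by
            rw [rpow_eq_mul_rpow_sub_one hp.le, ENNReal.mul_inv (by simp [hL0]) (by simp [hLt]),
              ← mul_assoc, ENNReal.mul_inv_cancel hL0 hLt, one_mul]
          rw [h1, div_eq_mul_inv]
          calc _ = A ^ (p - 1) * S ^ (p - 1) * (L * (L ^ p)⁻¹) * 1 := (mul_one _).symm
            _ = A ^ (p - 1) * S ^ (p - 1) * (L * (L ^ p)⁻¹) * (W⁻¹ * W) := by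
              rw [ENNReal.inv_mul_cancel hW0 hWt]
            _ = _ := by ring
      _ ≤ Z x * (K * L ^ p) * (L ^ p)⁻¹ := by gcongr
      _ = K * Z x := by
          rw [mul_assoc, mul_assoc, ENNReal.mul_inv_cancel, mul_one, mul_comm]
          · simp [hL0, hLt]
          · exact ENNReal.rpow_ne_top_of_nonneg (by linarith) hLt
  have hsp : s * p = q := by rw [hpq.conjugate_eq, hs]; field_simp
  have hZm : Measurable Z := measurable_avgMax
  calc ∫⁻ x, avgMax volume f x ^ p * w x
      ≤ ∫⁻ x, (K : ℝ≥0∞) ^ q * (Z x ^ q * w x) := by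
        refine lintegral_mono fun x => ?_
        rw [← mul_assoc, ← ENNReal.mul_rpow_of_nonneg _ _ hpq.symm.nonneg, ← hsp, ENNReal.rpow_mul]
        gcongr
        exact hpt x
    _ = (K : ℝ≥0∞) ^ q * ∫⁻ x, Z x ^ q ∂(volume.withDensity w) := by
        rw [lintegral_const_mul _ (f := fun x => Z x ^ q * w x) ((hZm.pow_const q).mul hwm),
          lintegral_withDensity_eq hwm (hZm.pow_const q)]
    _ ≤ (K : ℝ≥0∞) ^ q * (C₂ * ∫⁻ x, (m x ^ (p - 1) * (w x)⁻¹) ^ q ∂(volume.withDensity w)) := by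
        gcongr
        exact hC₂ _ _ hmw
    _ = (K : ℝ≥0∞) ^ q * (C₂ * ∫⁻ x, m x ^ p ∂(volume.withDensity σ)) := by
        rw [lintegral_withDensity_eq hwm (hmw.pow_const q),
          lintegral_withDensity_eq hσ.measurable (hmm.pow_const p)]
        congr 2
        refine lintegral_congr_ae ?_
        filter_upwards [hw.ae_ne_zero, hw.ae_ne_top] with t h0 h1
        rw [ENNReal.mul_rpow_of_nonneg _ _ hpq.symm.nonneg, ← ENNReal.rpow_mul,
          hpq.sub_one_mul_conj, mul_assoc, ← ENNReal.rpow_neg_one, ← ENNReal.rpow_mul, hσdef]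
        congr 1
        nth_rw 2 [← ENNReal.rpow_one (w t)]
        rw [← ENNReal.rpow_add _ _ h0 h1]
        congr 1
        rw [hq1]; ring
    _ ≤ (K : ℝ≥0∞) ^ q * (C₂ * (C₁ * ∫⁻ x, (f x * w x ^ s) ^ p ∂(volume.withDensity σ))) := by
        gcongr
        exact hC₁ _ _ hfw
    _ = ((K ^ q * (C₂ * C₁) : ℝ≥0) : ℝ≥0∞) * ∫⁻ x, f x ^ p * w x := by
        rw [lintegral_withDensity_eq hσ.measurable (hfw.pow_const p)]
        have : ∫⁻ x, (f x * w x ^ s) ^ p * σ x = ∫⁻ x, f x ^ p * w x := by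
          refine lintegral_congr_ae ?_
          filter_upwards [hw.ae_ne_zero, hw.ae_ne_top] with t h0 h1
          rw [ENNReal.mul_rpow_of_nonneg _ _ hpq.nonneg, ← ENNReal.rpow_mul, hσdef, mul_assoc,
            ← ENNReal.rpow_add _ _ h0 h1, hsp, hq1, add_neg_cancel_right, ENNReal.rpow_one]
        rw [this]
        push_cast [ENNReal.coe_rpow_of_nonneg _ hpq.symm.nonneg]
        ring

end weights

/-! ### The Rubio de Francia algorithm and extrapolation -/

/-- Functions `u`, `z` with `M u ≤ c u` and `M z ≤ d z` produce the `A_p` weight `u ^ (1 - p) z`. -/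
theorem muckenhouptWeight_of_factors {p : ℝ} (hp : 1 < p) {u z : ℝ → ℝ≥0∞} {c d : ℝ≥0}
    (hu : Measurable u) (hz : Measurable z) (hu0 : ∀ᵐ x, u x ≠ 0) (hz0 : ∀ᵐ x, z x ≠ 0)
    (hut : ∀ᵐ x, u x ≠ ∞) (hzt : ∀ᵐ x, z x ≠ ∞) (hMu : ∀ x, avgMax volume u x ≤ c * u x)
    (hMz : ∀ x, avgMax volume z x ≤ d * z x) :
    MuckenhouptWeight p (c ^ (p - 1) * d) fun x => u x ^ (1 - p) * z x where
  measurable := (hu.pow_const _).mul hz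
  ae_ne_zero := by
    filter_upwards [hu0, hut, hz0] with x h0 h1 h2
    simp [h0, h1, h2]
  ae_ne_top := by
    filter_upwards [hu0, hut, hz0, hzt] with x h0 h1 h2 h3
    exact ENNReal.mul_ne_top (by simp [h0, h1]) h3
  bound I := by
    rcases (ratIoo I).eq_empty_or_nonempty with h | ⟨x₀, hx₀⟩
    · simp [h]
    have hp1 : 0 < p - 1 := by linarith
    set L := volume (ratIoo I)
    have hL0 : L ≠ 0 := volume_ratIoo_ne_zero hx₀
    have hLt : L ≠ ∞ := volume_ratIoo_ne_top I
    -- The number `a` is the average over the interval divided by `e`: a lower bound for `f` there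
    -- that is comparable to the average. It controls the negative power of `u` in the weight and
    -- the negative power of `z` in the dual weight.
    have key : ∀ {f : ℝ → ℝ≥0∞} {e : ℝ≥0}, Measurable f → (∀ᵐ x, f x ≠ 0) → (∀ᵐ x, f x ≠ ∞) →
        (∀ x, avgMax volume f x ≤ e * f x) → ∃ a : ℝ≥0∞, a ≠ 0 ∧ a ≠ ∞ ∧
          (∫⁻ x in ratIoo I, f x) = e * a * L ∧ (∀ x ∈ ratIoo I, a ≤ f x) := by
      intro f e hf hf0 hft hMf
      have h1 : ∀ x ∈ ratIoo I, (∫⁻ x in ratIoo I, f x) / L ≤ e * f x := fun x hx =>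
        (average_le_avgMax hx).trans (hMf x)
      have h2 : ∫⁻ x in ratIoo I, f x ≠ 0 := setLIntegral_ratIoo_ne_zero hx₀ hf hf0
      obtain ⟨y, hy, hyt⟩ := exists_mem_ratIoo_of_ae hx₀ hft
      have hAt : (∫⁻ x in ratIoo I, f x) / L ≠ ∞ :=
        ne_top_of_le_ne_top (ENNReal.mul_ne_top ENNReal.coe_ne_top hyt) (h1 y hy)
      have hA0 : (∫⁻ x in ratIoo I, f x) / L ≠ 0 := by simp [h2, hLt]
      have he : (e : ℝ≥0∞) ≠ 0 := by
        intro he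
        have := h1 y hy
        rw [he, zero_mul] at this
        exact hA0 (le_antisymm this zero_le)
      refine ⟨(∫⁻ x in ratIoo I, f x) / L / e, ?_, ?_, ?_, fun x hx => ?_⟩
      · simp [h2, hLt]
      · exact ENNReal.div_ne_top hAt he
      · rw [ENNReal.mul_div_cancel he ENNReal.coe_ne_top, ENNReal.div_mul_cancel hL0 hLt]
      · exact ENNReal.div_le_of_le_mul' (h1 x hx)
    obtain ⟨a, ha0, hat, haI, ha⟩ := key hu hu0 hut hMu
    obtain ⟨b, hb0, hbt, hbI, hb⟩ := key hz hz0 hzt hMz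
    have e1 : ∫⁻ x in ratIoo I, u x ^ (1 - p) * z x ≤ (a ^ (p - 1))⁻¹ * (d * b * L) := by
      rw [← hbI, ← lintegral_const_mul _ hz]
      refine setLIntegral_mono' (measurableSet_ratIoo I) fun x hx => ?_
      gcongr
      rw [← neg_sub, ENNReal.rpow_neg]
      gcongr
      exact ha x hx
    have e2 : ∫⁻ x in ratIoo I, (u x ^ (1 - p) * z x) ^ (-(p - 1)⁻¹) ≤
        (b ^ (p - 1)⁻¹)⁻¹ * (c * a * L) := by
      rw [← haI, ← lintegral_const_mul _ hu]
      refine lintegral_mono_ae ?_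
      filter_upwards [ae_restrict_mem (measurableSet_ratIoo I), ae_restrict_of_ae hu0,
        ae_restrict_of_ae hut, ae_restrict_of_ae hz0] with x hx h0 h1 h2
      rw [ENNReal.mul_rpow_of_ne_zero (by simp [h0, h1]) h2, ← ENNReal.rpow_mul, mul_comm]
      have : (1 - p) * -(p - 1)⁻¹ = 1 := by field_simp; ring
      rw [this, ENNReal.rpow_one, ENNReal.rpow_neg]
      gcongr
      exact hb x hx
    calc _ ≤ (a ^ (p - 1))⁻¹ * (d * b * L) * ((b ^ (p - 1)⁻¹)⁻¹ * (c * a * L)) ^ (p - 1) := by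
          gcongr
      _ = (a ^ (p - 1))⁻¹ * (d * b * L) * (b⁻¹ * (c ^ (p - 1) * a ^ (p - 1) * L ^ (p - 1))) := by
          rw [ENNReal.mul_rpow_of_nonneg _ _ hp1.le, ENNReal.mul_rpow_of_nonneg _ _ hp1.le,
            ENNReal.mul_rpow_of_nonneg _ _ hp1.le, ENNReal.inv_rpow, ← ENNReal.rpow_mul,
            inv_mul_cancel₀ hp1.ne', ENNReal.rpow_one]
      _ = ((a ^ (p - 1))⁻¹ * a ^ (p - 1)) * (b⁻¹ * b) * (c ^ (p - 1) * d * (L * L ^ (p - 1))) := by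
          ring
      _ = _ := by
          rw [ENNReal.inv_mul_cancel (by simp [ha0, hat]) (by simp [ha0, hat]),
            ENNReal.inv_mul_cancel hb0 hbt, ← rpow_eq_mul_rpow_sub_one hp.le, one_mul, one_mul,
            ENNReal.coe_mul, ENNReal.coe_rpow_of_nonneg _ hp1.le]

/-- The Rubio de Francia algorithm. -/
theorem exists_majorant {p : ℝ} (hp : 1 < p) (B : ℝ≥0) : ∃ c : ℝ≥0, ∀ w : ℝ → ℝ≥0∞, Measurable w →
    (∀ᵐ x, w x ≠ ∞) →
    (∀ f : ℝ → ℝ≥0∞, Measurable f →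
      ∫⁻ x, avgMax volume f x ^ p * w x ≤ B * ∫⁻ x, f x ^ p * w x) →
    ∀ h : ℝ → ℝ≥0∞, Measurable h → ∃ u : ℝ → ℝ≥0∞, Measurable u ∧ (∀ x, h x ≤ u x) ∧
      (∀ x, avgMax volume u x ≤ c * u x) ∧
      ∫⁻ x, u x ^ p * w x ≤ 2 ^ p * ∫⁻ x, h x ^ p * w x := by
  have hp0 : 0 < p := by linarith
  -- `b` bounds the norm of the maximal operator on L^p(w); the added 1 keeps it nonzero, so that
  -- `c` can be inverted.
  set b : ℝ≥0 := (B + 1) ^ (1 / p)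
  have hb0 : b ≠ 0 := by positivity
  set c : ℝ≥0 := 2 * b with hcdef
  have hc0 : c ≠ 0 := by positivity
  have hbp : (B : ℝ≥0∞) ^ (1 / p) ≤ b := by
    rw [← ENNReal.coe_rpow_of_nonneg _ (by positivity)]
    exact_mod_cast NNReal.rpow_le_rpow (by simp) (by positivity)
  refine ⟨c, fun w hw hwt hB h hh => ?_⟩
  set T : ℕ → ℝ → ℝ≥0∞ := fun k => (avgMax volume)^[k] h with hT
  have hTs : ∀ k, T (k + 1) = avgMax volume (T k) := fun k => Function.iterate_succ_apply' _ _ _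
  have hTm : ∀ k, Measurable (T k)
    | 0 => hh
    | k + 1 => by rw [hTs]; exact measurable_avgMax
  set ν := volume.withDensity w
  have hσf : SigmaFinite ν := SigmaFinite.withDensity_of_ne_top hwt
  set N : (ℝ → ℝ≥0∞) → ℝ≥0∞ := fun f => (∫⁻ x, f x ^ p ∂ν) ^ (1 / p) with hN
  have hNM : ∀ f, Measurable f → N (avgMax volume f) ≤ b * N f := by
    intro f hf
    have h1 := ENNReal.rpow_le_rpow (hB f hf) (z := 1 / p) (by positivity)
    rw [← lintegral_withDensity_eq hw (hf.pow_const p),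
      ← lintegral_withDensity_eq hw (measurable_avgMax.pow_const p),
      ENNReal.mul_rpow_of_nonneg _ _ (by positivity)] at h1
    exact h1.trans (by gcongr)
  have hNT : ∀ k, N (T k) ≤ b ^ k * N h := by
    intro k
    induction k with
    | zero => simp [hT]
    | succ k ih =>
      rw [hTs]
      calc _ ≤ b * N (T k) := hNM _ (hTm k)
        _ ≤ b * (b ^ k * N h) := by gcongr
        _ = _ := by ring
  -- The majorant is ∑ c^(-k) M^k h. Applying M shifts the series and costs a factor `c`; since c =
  -- 2b, the norms of the terms are dominated by a geometric series with sum 2.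
  set F : ℕ → ℝ → ℝ≥0∞ := fun k x => ((c⁻¹ : ℝ≥0) : ℝ≥0∞) ^ k * T k x with hF
  have hFm : ∀ k, Measurable (F k) := fun k => (hTm k).const_mul _
  refine ⟨fun x => ∑' k, F k x, Measurable.tsum hFm, fun x => ?_, fun x => ?_, ?_⟩
  · refine le_trans ?_ (ENNReal.le_tsum 0)
    simp [hF, hT]
  · refine (avgMax_tsum_le hFm x).trans ?_
    have h1 : ∀ k, avgMax volume (F k) x = c * F (k + 1) x := by
      intro k
      simp only [hF]
      rw [avgMax_const_mul (hTm k), hTs, pow_succ]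
      calc _ = 1 * (((c⁻¹ : ℝ≥0) : ℝ≥0∞) ^ k * avgMax volume (T k) x) := (one_mul _).symm
        _ = (c * (c⁻¹ : ℝ≥0) : ℝ≥0∞) * (((c⁻¹ : ℝ≥0) : ℝ≥0∞) ^ k * avgMax volume (T k) x) := by
          rw [← ENNReal.coe_mul, mul_inv_cancel₀ hc0, ENNReal.coe_one]
        _ = _ := by ring
    simp_rw [h1]
    rw [ENNReal.tsum_mul_left]
    refine mul_le_mul' le_rfl ?_
    exact ENNReal.tsum_comp_le_tsum_of_injective (add_left_injective 1) (fun k => F k x)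
  · have hNF : ∀ k, N (F k) ≤ 2⁻¹ ^ k * N h := by
      intro k
      have h1 : N (F k) = ((c⁻¹ : ℝ≥0) : ℝ≥0∞) ^ k * N (T k) := by
        simp only [hN, hF]
        simp_rw [ENNReal.mul_rpow_of_nonneg _ _ hp0.le]
        rw [lintegral_const_mul _ ((hTm k).pow_const p),
          ENNReal.mul_rpow_of_nonneg _ _ (by positivity), ← ENNReal.rpow_mul,
          mul_one_div_cancel hp0.ne', ENNReal.rpow_one]
      rw [h1]
      calc _ ≤ ((c⁻¹ : ℝ≥0) : ℝ≥0∞) ^ k * (b ^ k * N h) := by gcongr; exact hNT k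
        _ = _ := by
          rw [← mul_assoc, ← mul_pow, ← ENNReal.coe_mul]
          congr 2
          have : c⁻¹ * b = 2⁻¹ := by rw [hcdef]; field_simp
          rw [this, ENNReal.coe_inv two_ne_zero, ENNReal.coe_ofNat]
    have hmink := lintegral_lintegral_rpow_le (μ := ν) (ν := (Measure.count : Measure ℕ)) hp
      (φ := fun x k => F k x) (measurable_from_prod_countable_left fun k => hFm k)
    simp_rw [lintegral_count] at hmink
    have hsum : (∫⁻ x, (∑' k, F k x) ^ p ∂ν) ^ (1 / p) ≤ 2 * N h := by
      calc _ ≤ ∑' k, N (F k) := hmink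
        _ ≤ ∑' k, 2⁻¹ ^ k * N h := ENNReal.tsum_le_tsum hNF
        _ = 2 * N h := by
          rw [ENNReal.tsum_mul_right, ENNReal.tsum_geometric, ENNReal.one_sub_inv_two, inv_inv]
    have h2 := ENNReal.rpow_le_rpow hsum hp0.le
    rw [← ENNReal.rpow_mul, one_div_mul_cancel hp0.ne', ENNReal.rpow_one,
      ENNReal.mul_rpow_of_nonneg _ _ hp0.le, hN, ← ENNReal.rpow_mul, one_div_mul_cancel hp0.ne',
      ENNReal.rpow_one, lintegral_withDensity_eq hw (hh.pow_const p),
      lintegral_withDensity_eq hw ((Measurable.tsum hFm).pow_const p)] at h2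
    exact h2

theorem ae_ne_top_of_lintegral_rpow_mul_ne_top {p : ℝ} (hp : 0 < p) {u w : ℝ → ℝ≥0∞}
    (hu : Measurable u) (hw : Measurable w) (hw0 : ∀ᵐ x, w x ≠ 0)
    (h : ∫⁻ x, u x ^ p * w x ≠ ∞) : ∀ᵐ x, u x ≠ ∞ := by
  filter_upwards [hw0, ae_lt_top ((hu.pow_const p).mul hw) h] with x h0 h1 h2
  simp [h2, hp, h0] at h1

/-- At a zero of `u` all averages of `u` over intervals around that point vanish, hence so does the
integral of `f`. Majorants of nontrivial functions are thus positive everywhere, so negative powers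
of them are harmless. -/
theorem ne_zero_of_avgMax_le {f u : ℝ → ℝ≥0∞} {c : ℝ≥0} (hfu : ∀ x, f x ≤ u x)
    (hM : ∀ x, avgMax volume u x ≤ c * u x) (h : ∫⁻ x, f x ≠ 0) (x : ℝ) : u x ≠ 0 := by
  intro hx
  have hz : ∀ n : ℕ, ∫⁻ t in Ioo (-n : ℝ) n, f t = 0 := by
    intro n
    obtain ⟨m, hm⟩ := exists_nat_gt (max |x| n)
    have hxm : x ∈ ratIoo (-(m : ℚ), (m : ℚ)) := by
      have := (le_max_left _ _).trans_lt hm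
      rw [abs_lt] at this
      simpa [ratIoo] using this
    have h1 : (∫⁻ t in ratIoo (-(m : ℚ), (m : ℚ)), u t) / volume (ratIoo (-(m : ℚ), (m : ℚ))) ≤ 0 := by
      have := (average_le_avgMax (μ := volume) (f := u) hxm).trans (hM x)
      rwa [hx, mul_zero] at this
    rw [nonpos_iff_eq_zero, ENNReal.div_eq_zero_iff, or_iff_left (volume_ratIoo_ne_top _)] at h1
    refine le_antisymm ?_ zero_le
    rw [← h1]
    have hsub : Ioo (-n : ℝ) n ⊆ ratIoo (-(m : ℚ), (m : ℚ)) := by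
      have : (n : ℝ) ≤ m := ((le_max_right _ _).trans_lt hm).le
      simp only [ratIoo, Rat.cast_neg, Rat.cast_natCast]
      exact Ioo_subset_Ioo (by linarith) this
    exact (lintegral_mono_set hsub).trans (lintegral_mono hfu)
  refine h ?_
  have hU : (⋃ n : ℕ, Ioo (-n : ℝ) n) = univ := by
    refine eq_univ_of_forall fun y => ?_
    obtain ⟨m, hm⟩ := exists_nat_gt |y|
    exact mem_iUnion.mpr ⟨m, abs_lt.mp hm⟩
  have := lintegral_iUnion_le (μ := volume) (fun n : ℕ => Ioo (-n : ℝ) n) f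
  rw [hU, Measure.restrict_univ] at this
  simpa [hz] using this

/-- **Rubio de Francia extrapolation**, for a pair of functions. -/
theorem extrapolation {p₀ p : ℝ} (hp₀ : 1 < p₀) (hp : 1 < p) (K : ℝ≥0) : ∃ K' : ℝ≥0, ∀ C : ℝ≥0,
    ∃ C' : ℝ≥0, ∀ g h : ℝ → ℝ≥0∞, Measurable g → Measurable h →
      (∀ w, MuckenhouptWeight p₀ K' w → ∫⁻ x, g x ^ p₀ * w x ≤ C * ∫⁻ x, h x ^ p₀ * w x) →
      ∀ w, MuckenhouptWeight p K w → ∫⁻ x, g x ^ p * w x ≤ C' * ∫⁻ x, h x ^ p * w x := by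
  have hpq := Real.HolderConjugate.conjExponent hp
  set q := p.conjExponent
  have hpq₀ := Real.HolderConjugate.conjExponent hp₀
  set q₀ := p₀.conjExponent
  have hp0 : 0 < p := by linarith
  have hp00 : 0 < p₀ := by linarith
  have hp1 : 0 < p - 1 := by linarith
  have hq1 : q = 1 + (p - 1)⁻¹ := by rw [hpq.conjugate_eq]; field_simp; ring
  obtain ⟨B₁, hB₁⟩ := lintegral_avgMax_rpow_mul_le hp K
  obtain ⟨B₂, hB₂⟩ := lintegral_avgMax_rpow_mul_le hpq.symm.lt (K ^ (p - 1)⁻¹)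
  obtain ⟨c, hc⟩ := exists_majorant hp B₁
  obtain ⟨d, hd⟩ := exists_majorant hpq.symm.lt B₂
  have key : ∀ K' : ℝ≥0, c ^ (p₀ - 1) * d ≤ K' → ∀ w,
      MuckenhouptWeight p₀ (c ^ (p₀ - 1) * d) w → MuckenhouptWeight p₀ K' w := fun K' hK w hw =>
    ⟨hw.1, hw.2, hw.3, fun I => (hw.4 I).trans (by gcongr)⟩
  -- The 1 in the maximum admits the weight 1, needed when `h` vanishes almost everywhere; the other
  -- entry is the constant of the weight built from `u` and `z`. The `+ 1` makes the bound trivial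
  -- when the right-hand integral is infinite.
  refine ⟨max 1 (c ^ (p₀ - 1) * d), fun C => ⟨(4 * C ^ (1 / p₀)) ^ p + 1, ?_⟩⟩
  intro g h hg hh hgh w hw
  set X := ∫⁻ x, h x ^ p * w x
  rcases eq_or_ne X ∞ with hXt | hXt
  · rw [hXt, ENNReal.mul_top (by simp)]
    exact le_top
  rcases eq_or_ne (∫⁻ x, h x ^ p₀) 0 with hX0 | hX0
  · have h1 := hgh _ (muckenhouptWeight_one hp₀ (le_max_left _ _))
    simp only [mul_one, hX0, mul_zero, nonpos_iff_eq_zero] at h1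
    rw [lintegral_eq_zero_iff (hg.pow_const _)] at h1
    have : ∫⁻ x, g x ^ p * w x = 0 := by
      rw [lintegral_eq_zero_iff (f := fun x => g x ^ p * w x) ((hg.pow_const _).mul hw.1)]
      filter_upwards [h1] with x hx
      have : g x = 0 := by simpa [hp00, hp00.not_gt] using hx
      simp [this, hp0]
    simp [this]
  have hwm := hw.measurable
  have hσf : SigmaFinite (volume.withDensity w) := SigmaFinite.withDensity_of_ne_top hw.ae_ne_top
  rw [← lintegral_withDensity_eq hwm (hg.pow_const p)]
  refine lintegral_rpow_le_of_forall_le hp0 hg fun f hf hfg hYt => ?_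
  rw [lintegral_withDensity_eq hwm (hf.pow_const p)] at hYt ⊢
  set Y := ∫⁻ x, f x ^ p * w x with hY
  rcases eq_or_ne Y 0 with hY0 | hY0
  · simp [hY0]
  have hσ := hw.dual hpq
  -- The dual function of `f`: f k = f^p w, and its L^q norm with respect to the dual weight, to the
  -- power `q`, is again `Y`. The majorants `u` of `h` and `z` of `k` then give Y ≤ ∫ f z.
  set k : ℝ → ℝ≥0∞ := fun x => f x ^ (p - 1) * w x with hk
  have hkm : Measurable k := (hf.pow_const _).mul hwm
  obtain ⟨u, hu, hhu, hMu, huX⟩ := hc w hwm hw.ae_ne_top (hB₁ w hw) h hh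
  obtain ⟨z, hz, hkz, hMz, hzY⟩ := hd _ hσ.measurable hσ.ae_ne_top (hB₂ _ hσ) k hkm
  have hkY : ∫⁻ x, k x ^ q * w x ^ (-(p - 1)⁻¹) = Y := by
    refine lintegral_congr_ae ?_
    filter_upwards [hw.ae_ne_zero, hw.ae_ne_top] with x h0 h1
    rw [hk, ENNReal.mul_rpow_of_nonneg _ _ hpq.symm.nonneg, ← ENNReal.rpow_mul,
      hpq.sub_one_mul_conj, mul_assoc, ← ENNReal.rpow_add _ _ h0 h1, hq1, add_neg_cancel_right,
      ENNReal.rpow_one]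
  rw [hkY] at hzY
  have hut : ∀ᵐ x, u x ≠ ∞ := ae_ne_top_of_lintegral_rpow_mul_ne_top hp0 hu hwm hw.ae_ne_zero
    (ne_top_of_le_ne_top (ENNReal.mul_ne_top (by simp) hXt) huX)
  have hzt : ∀ᵐ x, z x ≠ ∞ := ae_ne_top_of_lintegral_rpow_mul_ne_top hpq.symm.pos hz hσ.measurable
    hσ.ae_ne_zero
    (ne_top_of_le_ne_top (ENNReal.mul_ne_top (by simp) hYt) hzY)
  have hu0 : ∀ x, u x ≠ 0 := by
    refine ne_zero_of_avgMax_le hhu hMu fun h0 => hX0 ?_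
    rw [lintegral_eq_zero_iff hh] at h0
    rw [lintegral_eq_zero_iff (hh.pow_const _)]
    filter_upwards [h0] with x hx
    simp [show h x = 0 from hx, hp00]
  have hz0 : ∀ x, z x ≠ 0 := by
    refine ne_zero_of_avgMax_le hkz hMz fun h0 => hY0 ?_
    rw [lintegral_eq_zero_iff hkm] at h0
    rw [hY, lintegral_eq_zero_iff (f := fun x => f x ^ p * w x) ((hf.pow_const _).mul hwm)]
    filter_upwards [h0] with x hx
    have hx' : f x ^ (p - 1) * w x = 0 := hx
    simp only [rpow_eq_mul_rpow_sub_one hp.le, mul_assoc, hx', mul_zero, Pi.zero_apply]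
  set V := ∫⁻ x, u x * z x
  have hW := muckenhouptWeight_of_factors hp₀ hu hz (.of_forall hu0) (.of_forall hz0) hut hzt hMu hMz
  have hfp : Y ≤ ∫⁻ x, f x * z x := by
    refine lintegral_mono fun x => ?_
    rw [rpow_eq_mul_rpow_sub_one hp.le, mul_assoc]
    gcongr
    exact hkz x
  -- Hölder for the splitting f z = [f (u^(1-p₀) z)^(1/p₀)] [(u z)^(1/q₀)]. The hypothesis, used for
  -- the A_{p₀} weight u^(1-p₀) z, together with h ≤ u, then bounds the first factor by (C
  -- V)^(1/p₀).
  have hfz : ∫⁻ x, f x * z x ≤ (∫⁻ x, f x ^ p₀ * (u x ^ (1 - p₀) * z x)) ^ (1 / p₀) *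
      V ^ (1 / q₀) := by
    have hm1 : Measurable fun x => f x * (u x ^ (1 - p₀) * z x) ^ (1 / p₀) :=
      hf.mul (hW.measurable.pow_const _)
    have hm2 : Measurable fun x => (u x * z x) ^ (1 / q₀) := (hu.mul hz).pow_const _
    have h1 := ENNReal.lintegral_mul_le_Lp_mul_Lq volume hpq₀ hm1.aemeasurable hm2.aemeasurable
    have h2 : ∀ x, ((u x * z x) ^ (1 / q₀)) ^ q₀ = u x * z x := fun x => by
      rw [← ENNReal.rpow_mul, one_div_mul_cancel hpq₀.symm.pos.ne', ENNReal.rpow_one]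
    have h3 : ∀ x, (f x * (u x ^ (1 - p₀) * z x) ^ (1 / p₀)) ^ p₀ =
        f x ^ p₀ * (u x ^ (1 - p₀) * z x) := fun x => by
      rw [ENNReal.mul_rpow_of_nonneg _ _ hp00.le, ← ENNReal.rpow_mul, one_div_mul_cancel hp00.ne',
        ENNReal.rpow_one]
    simp_rw [h2, h3] at h1
    refine le_trans (le_of_eq (lintegral_congr_ae ?_)) h1
    filter_upwards [hut, hzt] with x h4 h5
    rw [Pi.mul_apply, ENNReal.mul_rpow_of_nonneg _ _ (by positivity),
      ENNReal.mul_rpow_of_nonneg _ _ (one_div_nonneg.mpr hpq₀.symm.nonneg), ← ENNReal.rpow_mul]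
    have e1 : u x ^ ((1 - p₀) * (1 / p₀)) * u x ^ (1 / q₀) = 1 := by
      rw [← ENNReal.rpow_add _ _ (hu0 x) h4]
      have : (1 - p₀) * (1 / p₀) + 1 / q₀ = 0 := by
        rw [one_div q₀, ← hpq₀.one_sub_inv]; field_simp; ring
      rw [this, ENNReal.rpow_zero]
    have e2 : z x ^ (1 / p₀) * z x ^ (1 / q₀) = z x := by
      rw [← ENNReal.rpow_add _ _ (hz0 x) h5, one_div, one_div, hpq₀.inv_add_inv_eq_one,
        ENNReal.rpow_one]
    calc f x * z x = f x * (u x ^ ((1 - p₀) * (1 / p₀)) * u x ^ (1 / q₀)) *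
          (z x ^ (1 / p₀) * z x ^ (1 / q₀)) := by rw [e1, e2, mul_one]
      _ = _ := by ring
  have hfV : ∫⁻ x, f x ^ p₀ * (u x ^ (1 - p₀) * z x) ≤ C * V := by
    calc _ ≤ ∫⁻ x, g x ^ p₀ * (u x ^ (1 - p₀) * z x) := by
          refine lintegral_mono fun x => ?_
          gcongr
          exact hfg x
      _ ≤ C * ∫⁻ x, h x ^ p₀ * (u x ^ (1 - p₀) * z x) := hgh _ (key _ (le_max_right _ _) _ hW)
      _ ≤ C * V := by
          gcongr
          refine lintegral_mono_ae ?_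
          filter_upwards [hut] with x h4
          rw [← mul_assoc]
          gcongr
          calc h x ^ p₀ * u x ^ (1 - p₀) ≤ u x ^ p₀ * u x ^ (1 - p₀) := by gcongr; exact hhu x
            _ = u x := by
              rw [← ENNReal.rpow_add _ _ (hu0 x) h4, add_sub_cancel, ENNReal.rpow_one]
  -- Hölder between L^p(w) and its dual, with the norm bounds for the two majorants. The power of
  -- `Y` on the right is finally absorbed, which uses that `Y` is finite.
  have hVX : V ≤ (2 ^ p * X) ^ (1 / p) * (2 ^ q * Y) ^ (1 / q) := by
    have hm1 : Measurable fun x => u x * w x ^ (1 / p) := hu.mul (hwm.pow_const _)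
    have hm2 : Measurable fun x => z x * w x ^ (-(1 / p)) := hz.mul (hwm.pow_const _)
    have h1 := ENNReal.lintegral_mul_le_Lp_mul_Lq volume hpq hm1.aemeasurable hm2.aemeasurable
    have h2 : ∀ x, (u x * w x ^ (1 / p)) ^ p = u x ^ p * w x := fun x => by
      rw [ENNReal.mul_rpow_of_nonneg _ _ hp0.le, ← ENNReal.rpow_mul, one_div_mul_cancel hp0.ne',
        ENNReal.rpow_one]
    have h3 : ∀ x, (z x * w x ^ (-(1 / p))) ^ q = z x ^ q * w x ^ (-(p - 1)⁻¹) := fun x => by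
      rw [ENNReal.mul_rpow_of_nonneg _ _ hpq.symm.nonneg, ← ENNReal.rpow_mul]
      congr 2
      rw [hpq.conjugate_eq]; field_simp
    simp_rw [h2, h3] at h1
    refine le_trans (le_of_eq (lintegral_congr_ae ?_)) (h1.trans ?_)
    · filter_upwards [hw.ae_ne_zero, hw.ae_ne_top] with x h4 h5
      have : w x ^ (1 / p) * w x ^ (-(1 / p)) = 1 := by
        rw [← ENNReal.rpow_add _ _ h4 h5, add_neg_cancel, ENNReal.rpow_zero]
      calc u x * z x = u x * z x * (w x ^ (1 / p) * w x ^ (-(1 / p))) := by rw [this, mul_one]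
        _ = _ := by rw [Pi.mul_apply]; ring
    · have := hpq.symm.pos
      gcongr
  have htwo : ∀ (r : ℝ) (a : ℝ≥0∞), 0 < r → (2 ^ r * a) ^ (1 / r) = 2 * a ^ (1 / r) := by
    intro r a hr
    rw [ENNReal.mul_rpow_of_nonneg _ _ (by positivity), ← ENNReal.rpow_mul,
      mul_one_div_cancel hr.ne', ENNReal.rpow_one]
  have hVt : V ≠ ∞ := by
    refine ne_top_of_le_ne_top (ENNReal.mul_ne_top ?_ ?_) hVX
    · rw [htwo p X hp0]
      exact ENNReal.mul_ne_top (by simp) (ENNReal.rpow_ne_top_of_nonneg (by positivity) hXt)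
    · rw [htwo q Y hpq.symm.pos]
      exact ENNReal.mul_ne_top (by simp)
        (ENNReal.rpow_ne_top_of_nonneg (one_div_nonneg.mpr hpq.symm.nonneg) hYt)
  have hYV : Y ≤ (C : ℝ≥0∞) ^ (1 / p₀) * V := by
    calc Y ≤ (C * V) ^ (1 / p₀) * V ^ (1 / q₀) := hfp.trans (hfz.trans (by gcongr))
      _ = (C : ℝ≥0∞) ^ (1 / p₀) * (V ^ (1 / p₀) * V ^ (1 / q₀)) := by
          rw [ENNReal.mul_rpow_of_nonneg _ _ (by positivity), mul_assoc]
      _ = _ := by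
          rw [← ENNReal.rpow_add_of_nonneg _ _ (by positivity)
            (one_div_nonneg.mpr hpq₀.symm.nonneg), one_div, one_div, hpq₀.inv_add_inv_eq_one,
            ENNReal.rpow_one]
  have hfinal : Y ≤ (4 * (C : ℝ≥0∞) ^ (1 / p₀) * X ^ (1 / p)) * Y ^ (1 / q) := by
    calc Y ≤ (C : ℝ≥0∞) ^ (1 / p₀) * ((2 ^ p * X) ^ (1 / p) * (2 ^ q * Y) ^ (1 / q)) :=
          hYV.trans (by gcongr)
      _ = _ := by
          rw [htwo p X hp0, htwo q Y hpq.symm.pos]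
          ring
  calc Y ≤ (4 * (C : ℝ≥0∞) ^ (1 / p₀) * X ^ (1 / p)) ^ p := le_rpow_of_le_mul_rpow hpq hYt hfinal
    _ = (((4 * C ^ (1 / p₀)) ^ p : ℝ≥0) : ℝ≥0∞) * X := by
        rw [ENNReal.mul_rpow_of_nonneg _ _ hp0.le, ← ENNReal.rpow_mul, one_div_mul_cancel hp0.ne',
          ENNReal.rpow_one, ENNReal.coe_rpow_of_nonneg _ hp0.le, ENNReal.coe_mul,
          ENNReal.coe_rpow_of_nonneg _ (by positivity), ENNReal.coe_ofNat]
    _ ≤ _ := by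
        gcongr
        exact le_self_add

/-! ### Vector-valued maximal inequalities in mixed norm spaces -/

/-- A functional `N` on non-negative functions on `Ω`, such as a mixed norm, for which the
`N`-valued maximal operator on the line, acting pointwise on `Ω`, is bounded on `L^p(w)` for every
`1 < p < ∞` and every weight `w` of class `A_p`. -/
structure MaximalBounded {Ω : Type} [MeasurableSpace Ω] (N : (Ω → ℝ≥0∞) → ℝ≥0∞) : Prop where
  measurable : ∀ {α : Type} [MeasurableSpace α] (F : α → Ω → ℝ≥0∞),
    Measurable (Function.uncurry F) → Measurable fun a => N (F a)
  bound : ∀ p : ℝ, 1 < p → ∀ K : ℝ≥0, ∃ C : ℝ≥0, ∀ w, MuckenhouptWeight p K w →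
    ∀ F : ℝ → Ω → ℝ≥0∞, Measurable (Function.uncurry F) →
      ∫⁻ t, N (fun ω => avgMax volume (fun s => F s ω) t) ^ p * w t ≤ C * ∫⁻ t, N (F t) ^ p * w t

/-- The scalar case. A one-point Ω lets the ℓ^v norm and each Lebesgue norm be attached by the same
inductive step. -/
theorem maximalBounded_unit : MaximalBounded fun f : Unit → ℝ≥0∞ => f () where
  measurable F hF := hF.comp (measurable_id.prodMk measurable_const)
  bound p hp K := by
    obtain ⟨C, hC⟩ := lintegral_avgMax_rpow_mul_le hp K
    exact ⟨C, fun w hw F hF => hC w hw (fun t => F t ())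
      (hF.comp (measurable_id.prodMk measurable_const))⟩

/-- For exponent `q` the weighted integral in `t` and the integral in `y` commute, so the bound for
`N` may be applied for each fixed `y`. Extrapolation passes from `q` to every other exponent; this
is what forces all A_p weights into the definition although the goal is unweighted. -/
theorem MaximalBounded.lintegral_rpow {Ω : Type} [MeasurableSpace Ω] {N : (Ω → ℝ≥0∞) → ℝ≥0∞}
    (hN : MaximalBounded N) {Y : Type} [MeasurableSpace Y] (μ : Measure Y) [SFinite μ] {q : ℝ}
    (hq : 1 < q) :
    MaximalBounded fun f : Y × Ω → ℝ≥0∞ => (∫⁻ y, N (fun ω => f (y, ω)) ^ q ∂μ) ^ (1 / q) where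
  measurable {α} _ F hF := by
    have h := hN.measurable (fun (z : α × Y) ω => F z.1 (z.2, ω))
      (hF.comp (f := fun z : (α × Y) × Ω => (z.1.1, (z.1.2, z.2))) (by fun_prop))
    exact ((h.pow_const q).lintegral_prod_right (f := fun a y => N (fun ω => F a (y, ω)) ^ q)).pow_const _
  bound p hp K := by
    have hq0 : 0 < q := by linarith
    -- The order matters: extrapolation first names the A_q constant `K'` it needs, then `hN`
    -- supplies the bound for that class.
    obtain ⟨K', hK'⟩ := extrapolation hq hp K
    obtain ⟨C, hC⟩ := hN.bound q hq K'
    obtain ⟨C', hC'⟩ := hK' C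
    refine ⟨C', fun w hw F hF => ?_⟩
    have hF1 : Measurable fun z : (ℝ × Y) × Ω => F z.1.1 (z.1.2, z.2) :=
      hF.comp (f := fun z : (ℝ × Y) × Ω => (z.1.1, (z.1.2, z.2))) (by fun_prop)
    have hF2 : Measurable fun z : (ℝ × Y) × Ω =>
        avgMax volume (fun s => F s (z.1.2, z.2)) z.1.1 := by
      have h := measurable_avgMax_uncurry (μ := volume) (F := fun (a : Y × Ω) s => F s a)
        (hF.comp measurable_swap)
      exact h.comp (f := fun z : (ℝ × Y) × Ω => ((z.1.2, z.2), z.1.1)) (by fun_prop)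
    have hm1 := hN.measurable (fun (z : ℝ × Y) ω => F z.1 (z.2, ω)) hF1
    have hm2 := hN.measurable (fun (z : ℝ × Y) ω => avgMax volume (fun s => F s (z.2, ω)) z.1) hF2
    refine hC' _ _ ?_ ?_ (fun w₀ hw₀ => ?_) w hw
    · exact ((hm2.pow_const q).lintegral_prod_right
        (f := fun t y => N (fun ω => avgMax volume (fun s => F s (y, ω)) t) ^ q)).pow_const _
    · exact ((hm1.pow_const q).lintegral_prod_right
        (f := fun t y => N (fun ω => F t (y, ω)) ^ q)).pow_const _
    · simp_rw [← ENNReal.rpow_mul, one_div_mul_cancel hq0.ne', ENNReal.rpow_one]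
      have swap : ∀ {G : ℝ → Y → ℝ≥0∞}, Measurable (Function.uncurry G) →
          ∫⁻ t, (∫⁻ y, G t y ^ q ∂μ) * w₀ t = ∫⁻ y, (∫⁻ t, G t y ^ q * w₀ t) ∂μ := by
        intro G hG
        rw [← lintegral_lintegral_swap
          ((hG.pow_const q).mul (hw₀.measurable.comp measurable_fst)).aemeasurable]
        refine lintegral_congr fun t => ?_
        rw [lintegral_mul_const]
        exact (hG.comp (measurable_const.prodMk measurable_id)).pow_const q
      rw [swap (G := fun t y => N fun ω => avgMax volume (fun s => F s (y, ω)) t) hm2,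
        swap (G := fun t y => N fun ω => F t (y, ω)) hm1, ← lintegral_const_mul]
      · exact lintegral_mono fun y => hC w₀ hw₀ (fun t ω => F t (y, ω))
          (hF.comp (f := fun z : ℝ × Ω => (z.1, (y, z.2))) (by fun_prop))
      · exact ((hm1.pow_const q).mul (hw₀.measurable.comp measurable_fst)).lintegral_prod_left

theorem mixedNorm_mono : ∀ {n : ℕ} {p : Fin n → ℝ}, (∀ i, 1 < p i) →
    ∀ {F G : (Fin n → ℝ) → ℝ≥0∞}, (∀ x, F x ≤ G x) → mixedNorm n p F ≤ mixedNorm n p G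
  | 0, _, _, _, _, h => h _
  | n + 1, p, hp, F, G, h => by
    have := hp 0
    refine mixedNorm_mono (fun i => hp i.succ) fun y => ?_
    gcongr
    exact h _

theorem mixedNorm_const_mul : ∀ {n : ℕ} {p : Fin n → ℝ}, (∀ i, 1 < p i) → ∀ (c : ℝ≥0∞), c ≠ ∞ →
    ∀ (F : (Fin n → ℝ) → ℝ≥0∞), mixedNorm n p (fun x => c * F x) = c * mixedNorm n p F
  | 0, _, _, _, _, _ => rfl
  | n + 1, p, hp, c, hc, F => by
    have := hp 0
    rw [mixedNorm, mixedNorm, ← mixedNorm_const_mul (fun i => hp i.succ) c hc]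
    congr 1
    funext y
    simp_rw [ENNReal.mul_rpow_of_nonneg _ _ (show 0 ≤ p 0 by linarith)]
    rw [lintegral_const_mul' _ _ (ENNReal.rpow_ne_top_of_nonneg (by linarith) hc),
      ENNReal.mul_rpow_of_nonneg _ _ (by positivity), ← ENNReal.rpow_mul,
      mul_one_div_cancel (by linarith), ENNReal.rpow_one]

theorem measurable_fin_cons {n : ℕ} :
    Measurable fun z : ℝ × (Fin n → ℝ) => (Fin.cons z.1 z.2 : Fin (n + 1) → ℝ) := by
  refine measurable_pi_iff.mpr fun i => ?_
  refine Fin.cases ?_ (fun j => ?_) i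
  · simpa using measurable_fst
  · simp only [Fin.cons_succ]
    exact (measurable_pi_apply j).comp measurable_snd

/-- The composition of the one-dimensional maximal operators in all coordinates. -/
noncomputable def iterMax : (n : ℕ) → ((Fin n → ℝ) → ℝ≥0∞) → (Fin n → ℝ) → ℝ≥0∞
  | 0, F, x => F x
  | n + 1, F, x =>
      iterMax n (fun y => avgMax volume (fun s => F (Fin.cons s y)) (x 0)) (Fin.tail x)

/-- Induction on the dimension, with the norm in the first coordinate absorbed into `N`: the
remaining operators act on functions with values in L^{p_1}(ℝ; N), again a `MaximalBounded`
functional. The operator in the first coordinate acts first and is handled by the bound for `N` with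
weight 1. -/
theorem exists_mixedNorm_iterMax_le : ∀ {n : ℕ} {p : Fin n → ℝ}, (∀ i, 1 < p i) →
    ∀ {Ω : Type} [MeasurableSpace Ω] {N : (Ω → ℝ≥0∞) → ℝ≥0∞}, MaximalBounded N → ∃ C : ℝ≥0,
      ∀ F : (Fin n → ℝ) → Ω → ℝ≥0∞, Measurable (Function.uncurry F) →
        mixedNorm n p (fun x => N fun ω => iterMax n (fun y => F y ω) x) ≤
          C * mixedNorm n p fun x => N (F x)
  | 0, _, _, _, _, _, _ => ⟨1, fun F _ => by simp [mixedNorm, iterMax]⟩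
  | n + 1, p, hp, Ω, _, N, hN => by
    have hp0 : 0 < p 0 := by linarith [hp 0]
    obtain ⟨C₁, hC₁⟩ := exists_mixedNorm_iterMax_le (fun i => hp i.succ)
      (hN.lintegral_rpow (volume : Measure ℝ) (hp 0))
    obtain ⟨C₂, hC₂⟩ := hN.bound (p 0) (hp 0) 1
    refine ⟨C₁ * C₂ ^ (1 / p 0), fun F hF => ?_⟩
    set H : (Fin n → ℝ) → ℝ × Ω → ℝ≥0∞ := fun y z =>
      avgMax volume (fun s => F (Fin.cons s y) z.2) z.1 with hH
    have hFc : Measurable fun z : ((Fin n → ℝ) × Ω) × ℝ =>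
        F (Fin.cons z.2 z.1.1 : Fin (n + 1) → ℝ) z.1.2 :=
      hF.comp ((measurable_fin_cons.comp (measurable_snd.prodMk
        (measurable_fst.comp measurable_fst))).prodMk (measurable_snd.comp measurable_fst))
    have hHm : Measurable (Function.uncurry H) :=
      (measurable_avgMax_uncurry (μ := volume)
        (F := fun (a : (Fin n → ℝ) × Ω) s => F (Fin.cons s a.1 : Fin (n + 1) → ℝ) a.2) hFc).comp
        (f := fun z : (Fin n → ℝ) × (ℝ × Ω) => ((z.1, z.2.2), z.2.1)) (by fun_prop)
    have h1 := hC₁ H hHm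
    rw [mixedNorm, mixedNorm]
    simp only [iterMax, Fin.cons_zero, Fin.tail_cons]
    refine h1.trans ?_
    rw [ENNReal.coe_mul, mul_assoc, ← mixedNorm_const_mul (fun i => hp i.succ)
      ((C₂ ^ (1 / p 0) : ℝ≥0) : ℝ≥0∞) ENNReal.coe_ne_top]
    refine mul_le_mul' le_rfl (mixedNorm_mono (fun i => hp i.succ) fun y => ?_)
    rw [ENNReal.coe_rpow_of_nonneg _ (by positivity), ← ENNReal.mul_rpow_of_nonneg _ _ (by positivity)]
    gcongr
    have := hC₂ _ (muckenhouptWeight_one (hp 0) le_rfl) (fun s ω => F (Fin.cons s y) ω)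
      (hFc.comp (f := fun z : ℝ × Ω => ((y, z.2), z.1)) (by fun_prop))
    simpa only [mul_one] using this

/-- The Fefferman–Stein inequality in mixed norm spaces, for the iterated maximal operator. -/
theorem exists_mixedNorm_tsum_iterMax_le {n : ℕ} {p : Fin n → ℝ} (hp : ∀ i, 1 < p i) {v : ℝ}
    (hv : 1 < v) : ∃ C : ℝ≥0, ∀ F : ℕ → (Fin n → ℝ) → ℝ≥0∞, (∀ j, Measurable (F j)) →
      mixedNorm n p (fun x => (∑' j, iterMax n (F j) x ^ v) ^ (1 / v)) ≤
        C * mixedNorm n p fun x => (∑' j, F j x ^ v) ^ (1 / v) := by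
  obtain ⟨C, hC⟩ := exists_mixedNorm_iterMax_le hp
    (maximalBounded_unit.lintegral_rpow (Measure.count : Measure ℕ) hv)
  refine ⟨C, fun F hF => ?_⟩
  have h := hC (fun x z => F z.1 x) (by
    have h1 : Measurable fun z : (Fin n → ℝ) × ℕ => F z.2 z.1 :=
      measurable_from_prod_countable_left fun j => hF j
    exact h1.comp (f := fun z : (Fin n → ℝ) × (ℕ × Unit) => (z.1, z.2.1)) (by fun_prop))
  simpa only [lintegral_count] using h

/-! ### Domination of the maximal function over balls -/

theorem lintegral_fin_succ {n : ℕ} {G : (Fin (n + 1) → ℝ) → ℝ≥0∞} (hG : Measurable G) :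
    ∫⁻ x, G x = ∫⁻ y : Fin n → ℝ, ∫⁻ s : ℝ, G (Fin.cons s y) := by
  have h := (volume_preserving_piFinSuccAbove (fun _ : Fin (n + 1) => ℝ) 0).symm
  have hG' : Measurable fun z : ℝ × (Fin n → ℝ) => G (Fin.cons z.1 z.2) :=
    hG.comp measurable_fin_cons
  rw [← h.lintegral_comp hG, ← lintegral_prod_symm _ hG'.aemeasurable]
  refine lintegral_congr fun z => ?_
  simp [MeasurableEquiv.piFinSuccAbove, Fin.insertNthEquiv]

/-- Averaging over the first side of the box costs the maximal operator in that coordinate; the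
result is a function of the other coordinates, to which induction applies. -/
theorem setLIntegral_pi_ratIoo_le : ∀ {n : ℕ} (I : Fin n → ℚ × ℚ) {F : (Fin n → ℝ) → ℝ≥0∞},
    Measurable F → ∀ {x : Fin n → ℝ}, (∀ i, x i ∈ ratIoo (I i)) →
      ∫⁻ y in univ.pi fun i => ratIoo (I i), F y ≤ (∏ i, volume (ratIoo (I i))) * iterMax n F x
  | 0, I, F, hF, x, hx => by
    have h1 : (univ.pi fun i : Fin 0 => ratIoo (I i)) = univ := by
      ext; simp
    rw [h1, Measure.restrict_univ, volume_pi, Measure.pi_of_empty (x := x), lintegral_dirac]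
    simp [iterMax]
  | n + 1, I, F, hF, x, hx => by
    have hm : MeasurableSet (univ.pi fun i => ratIoo (I i)) :=
      MeasurableSet.univ_pi fun i => measurableSet_ratIoo (I i)
    have hm' : MeasurableSet (univ.pi fun i : Fin n => ratIoo (I i.succ)) :=
      MeasurableSet.univ_pi fun i => measurableSet_ratIoo (I i.succ)
    have hFc : Measurable fun z : (Fin n → ℝ) × ℝ => F (Fin.cons z.2 z.1) :=
      hF.comp (measurable_fin_cons.comp measurable_swap)
    set A : (Fin n → ℝ) → ℝ≥0∞ := fun y => avgMax volume (fun s => F (Fin.cons s y)) (x 0)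
    have hAm : Measurable A :=
      (measurable_avgMax_uncurry (μ := volume) (F := fun y s => F (Fin.cons s y)) hFc).comp
        (f := fun y => (y, x 0)) (by fun_prop)
    rw [← lintegral_indicator hm, lintegral_fin_succ (hF.indicator hm)]
    calc ∫⁻ y : Fin n → ℝ, ∫⁻ s, (univ.pi fun i => ratIoo (I i)).indicator F (Fin.cons s y)
        = ∫⁻ y in univ.pi fun i : Fin n => ratIoo (I i.succ), ∫⁻ s in ratIoo (I 0),
            F (Fin.cons s y) := by
          rw [← lintegral_indicator hm']
          refine lintegral_congr fun y => ?_
          by_cases hy : y ∈ univ.pi fun i : Fin n => ratIoo (I i.succ)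
          · rw [indicator_of_mem hy, ← lintegral_indicator (measurableSet_ratIoo _)]
            refine lintegral_congr fun s => ?_
            have : (Fin.cons s y : Fin (n + 1) → ℝ) ∈ (univ.pi fun i => ratIoo (I i)) ↔
                s ∈ ratIoo (I 0) := by
              rw [mem_univ_pi, Fin.forall_fin_succ]
              simp only [Fin.cons_zero, Fin.cons_succ]
              exact and_iff_left fun i => hy i trivial
            by_cases hs : s ∈ ratIoo (I 0)
            · rw [indicator_of_mem (this.mpr hs), indicator_of_mem hs]
            · rw [indicator_of_notMem (mt this.mp hs), indicator_of_notMem hs]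
          · rw [indicator_of_notMem hy]
            refine (lintegral_congr fun s => indicator_of_notMem (fun h => hy ?_) _).trans
              lintegral_zero
            intro i _
            simpa using h i.succ trivial
      _ ≤ ∫⁻ y in univ.pi fun i : Fin n => ratIoo (I i.succ), volume (ratIoo (I 0)) * A y := by
          refine lintegral_mono fun y => ?_
          have h0 := volume_ratIoo_ne_zero (hx 0)
          have h1 := volume_ratIoo_ne_top (I 0)
          rw [mul_comm, ← ENNReal.div_le_iff h0 h1]
          exact average_le_avgMax (hx 0)
      _ = volume (ratIoo (I 0)) * ∫⁻ y in univ.pi fun i : Fin n => ratIoo (I i.succ), A y :=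
          lintegral_const_mul _ hAm
      _ ≤ volume (ratIoo (I 0)) *
            ((∏ i : Fin n, volume (ratIoo (I i.succ))) * iterMax n A (Fin.tail x)) := by
          gcongr
          exact setLIntegral_pi_ratIoo_le (fun i => I i.succ) hAm fun i => hx i.succ
      _ = _ := by
          rw [Fin.prod_univ_succ, iterMax, mul_assoc]

/-- The constant in `maximal_le_iterMax`. -/
noncomputable def ballConst (n : ℕ) : ℝ≥0∞ :=
  4 ^ n / volume (Metric.ball (0 : EuclideanSpace ℝ (Fin n)) 1)

theorem ballConst_ne_top (n : ℕ) : ballConst n ≠ ∞ :=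
  ENNReal.div_ne_top (by simp) (Metric.measure_ball_pos _ _ one_pos).ne'

theorem div_volume_ball (n : ℕ) (c : EuclideanSpace ℝ (Fin n)) {ρ : ℝ} (hρ : 0 < ρ) :
    ENNReal.ofReal (4 * ρ) ^ n / volume (Metric.ball c ρ) = ballConst n := by
  rw [Measure.addHaar_ball_of_pos _ _ hρ, finrank_euclideanSpace_fin, ballConst,
    ENNReal.ofReal_mul (by norm_num), mul_pow, ENNReal.ofReal_pow hρ.le, mul_comm,
    ENNReal.mul_div_mul_left, ENNReal.ofReal_ofNat]
  · simp [hρ]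
  · simp

/-- A ball of radius ρ fits in a box with rational corners and sides at most 4ρ, whose volume is at
most `ballConst n` times that of the ball. -/
theorem maximal_le_iterMax {n : ℕ} {F : EuclideanSpace ℝ (Fin n) → ℝ≥0∞} (hF : Measurable F)
    (x : EuclideanSpace ℝ (Fin n)) :
    maximal F x ≤ ballConst n * iterMax n (fun y => F (WithLp.toLp 2 y)) x.ofLp := by
  refine iSup_le fun c => iSup_le fun ρ => iSup_le fun hx => ?_
  have hρ : 0 < ρ := Metric.pos_of_mem_ball hx
  choose a ha using fun i => exists_rat_btwn (show c i - 2 * ρ < c i - ρ by linarith)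
  choose b hb using fun i => exists_rat_btwn (show c i + ρ < c i + 2 * ρ by linarith)
  set I : Fin n → ℚ × ℚ := fun i => (a i, b i)
  have hball : ∀ y ∈ Metric.ball c ρ, ∀ i, y i ∈ ratIoo (I i) := by
    intro y hy i
    have h1 : |y i - c i| < ρ := by
      have := PiLp.norm_apply_le (y - c) i
      rw [Metric.mem_ball, dist_eq_norm] at hy
      exact lt_of_le_of_lt this hy
    rw [abs_lt] at h1
    have h2 := ha i
    have h3 := hb i
    simp only [ratIoo, I, mem_Ioo]
    constructor <;> linarith
  set S : Set (Fin n → ℝ) := univ.pi fun i => ratIoo (I i)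
  have hS : MeasurableSet S := MeasurableSet.univ_pi fun i => measurableSet_ratIoo (I i)
  have hFm : Measurable fun y : Fin n → ℝ => F (WithLp.toLp 2 y) :=
    hF.comp (WithLp.measurable_toLp 2 _)
  have h1 : ∫⁻ y in Metric.ball c ρ, F y ≤ ∫⁻ y in S, F (WithLp.toLp 2 y) := by
    have hpre : WithLp.toLp 2 ⁻¹' (Metric.ball c ρ) ⊆ S := fun y hy i _ => hball _ hy i
    rw [← (PiLp.volume_preserving_toLp (Fin n)).setLIntegral_comp_preimage measurableSet_ball hF]
    exact lintegral_mono_set hpre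
  have h2 := setLIntegral_pi_ratIoo_le I hFm (x := x.ofLp) (hball x hx)
  have h3 : ∏ i, volume (ratIoo (I i)) ≤ ENNReal.ofReal (4 * ρ) ^ n := by
    calc _ ≤ ∏ _i : Fin n, ENNReal.ofReal (4 * ρ) := by
          refine Finset.prod_le_prod' fun i _ => ?_
          simp only [ratIoo, I, Real.volume_Ioo]
          have h2 := ha i
          have h3 := hb i
          exact ENNReal.ofReal_le_ofReal (by linarith)
      _ = _ := by simp
  rw [← div_volume_ball n c hρ]
  calc (∫⁻ y in Metric.ball c ρ, F y) / volume (Metric.ball c ρ)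
      ≤ (ENNReal.ofReal (4 * ρ) ^ n * iterMax n (fun y => F (WithLp.toLp 2 y)) x.ofLp) /
          volume (Metric.ball c ρ) := by
        gcongr
        exact h1.trans (h2.trans (by gcongr))
    _ = _ := by rw [div_eq_mul_inv, div_eq_mul_inv]; ring

/-! ### Elementary inequalities for mixed norms on cubes -/

/-- A triangle inequality with a constant, in which only one function has to be measurable. -/
theorem mixedNorm_add_le : ∀ {n : ℕ} {p : Fin n → ℝ}, (∀ i, 1 < p i) →
    ∀ {F G : (Fin n → ℝ) → ℝ≥0∞}, Measurable G →
      mixedNorm n p (fun x => F x + G x) ≤ 2 ^ n * (mixedNorm n p F + mixedNorm n p G)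
  | 0, _, _, _, _, _ => by simp [mixedNorm]
  | n + 1, p, hp, F, G, hG => by
    have hp0 : 1 < p 0 := hp 0
    have hGc : Measurable fun z : (Fin n → ℝ) × ℝ => G (Fin.cons z.2 z.1) :=
      hG.comp (measurable_fin_cons.comp measurable_swap)
    have hinv : (1 : ℝ) / p 0 ≤ 1 := by rw [div_le_one (by linarith)]; exact hp0.le
    rw [mixedNorm, mixedNorm, mixedNorm]
    calc _ ≤ mixedNorm n (fun i => p i.succ) fun y => 2 *
          ((∫⁻ s : ℝ, F (Fin.cons s y) ^ p 0) ^ (1 / p 0) +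
            (∫⁻ s : ℝ, G (Fin.cons s y) ^ p 0) ^ (1 / p 0)) := by
          refine mixedNorm_mono (fun i => hp i.succ) fun y => ?_
          have hGy : Measurable fun s : ℝ => G (Fin.cons s y) :=
            hGc.comp (measurable_const.prodMk measurable_id)
          calc (∫⁻ s : ℝ, (F (Fin.cons s y) + G (Fin.cons s y)) ^ p 0) ^ (1 / p 0)
              ≤ (2 ^ p 0 * ((∫⁻ s : ℝ, F (Fin.cons s y) ^ p 0) +
                  ∫⁻ s : ℝ, G (Fin.cons s y) ^ p 0)) ^ (1 / p 0) := by
                gcongr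
                -- Additivity needs only `G` measurable. In the application `F` is built from the
                -- maximal function over balls, whose measurability is never used.
                rw [← lintegral_add_right _ (hGy.pow_const _),
                  ← lintegral_const_mul' _ _ (by simp)]
                refine lintegral_mono fun s => ?_
                refine (ENNReal.rpow_add_le_mul_rpow_add_rpow _ _ hp0.le).trans ?_
                gcongr
                · norm_num
                · linarith
            _ = 2 * ((∫⁻ s : ℝ, F (Fin.cons s y) ^ p 0) +
                  ∫⁻ s : ℝ, G (Fin.cons s y) ^ p 0) ^ (1 / p 0) := by
                rw [ENNReal.mul_rpow_of_nonneg _ _ (by positivity), ← ENNReal.rpow_mul,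
                  mul_one_div_cancel (by linarith), ENNReal.rpow_one]
            _ ≤ _ := by
                gcongr
                exact ENNReal.rpow_add_le_add_rpow _ _ (by positivity) hinv
      _ = 2 * mixedNorm n (fun i => p i.succ) fun y =>
          ((∫⁻ s : ℝ, F (Fin.cons s y) ^ p 0) ^ (1 / p 0) +
            (∫⁻ s : ℝ, G (Fin.cons s y) ^ p 0) ^ (1 / p 0)) :=
          mixedNorm_const_mul (fun i => hp i.succ) 2 (by simp) _
      _ ≤ 2 * (2 ^ n * _) := by
          refine mul_le_mul' le_rfl (mixedNorm_add_le (fun i => hp i.succ) ?_)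
          exact ((hGc.pow_const (p 0)).lintegral_prod_right'
            (ν := (volume : Measure ℝ))).pow_const (1 / p 0)
      _ = _ := by rw [pow_succ]; ring

theorem mixedNorm_congr_ae : ∀ {n : ℕ} {p : Fin n → ℝ}, (∀ i, 1 < p i) →
    ∀ {F G : (Fin n → ℝ) → ℝ≥0∞}, F =ᵐ[volume] G → mixedNorm n p F = mixedNorm n p G
  | 0, _, _, F, G, h => by
    -- In dimension zero the volume is a point mass, so equality almost everywhere is equality.
    obtain ⟨x, hx⟩ := h.exists
    rwa [Subsingleton.elim x Fin.elim0] at hx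
  | n + 1, p, hp, F, G, h => by
    rw [mixedNorm, mixedNorm]
    refine mixedNorm_congr_ae (fun i => hp i.succ) ?_
    have h1 := (volume_preserving_piFinSuccAbove (fun _ : Fin (n + 1) => ℝ) 0).symm
    have h2 := (h1.comp Measure.measurePreserving_swap).quasiMeasurePreserving.ae_eq_comp h
    have h3 : ∀ᵐ y : Fin n → ℝ, ∀ᵐ s : ℝ, F (Fin.cons s y) = G (Fin.cons s y) := by
      refine Measure.ae_ae_of_ae_prod (μ := (volume : Measure (Fin n → ℝ)))
        (ν := (volume : Measure ℝ)) (p := fun z => F (Fin.cons z.2 z.1) = G (Fin.cons z.2 z.1)) ?_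
      filter_upwards [h2] with z hz
      simpa [MeasurableEquiv.piFinSuccAbove, Fin.insertNthEquiv] using hz
    filter_upwards [h3] with y hy
    congr 1
    refine lintegral_congr_ae ?_
    filter_upwards [hy] with s hs
    rw [hs]

theorem lintegral_eq_of_forall_abs_lt {t : ℝ} {F : ℝ → ℝ≥0∞} (h : ∀ s, ¬ |s| < t → F s = 0) :
    ∫⁻ s, F s = ∫⁻ s in Ioo (-t) t, F s := by
  rw [← lintegral_indicator measurableSet_Ioo]
  refine lintegral_congr fun s => ?_
  by_cases hs : s ∈ Ioo (-t) t
  · rw [indicator_of_mem hs]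
  · rw [indicator_of_notMem hs, h s fun hs' => hs (abs_lt.mp hs')]

/-- Hölder's inequality on a cube. -/
theorem lintegral_le_mixedNorm : ∀ {n : ℕ} {p : Fin n → ℝ}, (∀ i, 1 < p i) → ∀ {t : ℝ}, 0 < t →
    ∀ {F : (Fin n → ℝ) → ℝ≥0∞}, Measurable F → (∀ x, ¬ (∀ i, |x i| < t) → F x = 0) →
      ∫⁻ x, F x ≤ ENNReal.ofReal (2 * t) ^ (∑ i, (1 - 1 / p i)) * mixedNorm n p F
  | 0, _, _, t, _, F, _, _ => by
    rw [volume_pi, Measure.pi_of_empty (x := Fin.elim0), lintegral_dirac]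
    simp [mixedNorm]
  | n + 1, p, hp, t, ht, F, hF, hFt => by
    have hp0 : 1 < p 0 := hp 0
    have hpq := Real.HolderConjugate.conjExponent hp0
    have hFc : Measurable fun z : (Fin n → ℝ) × ℝ => F (Fin.cons z.2 z.1) :=
      hF.comp (measurable_fin_cons.comp measurable_swap)
    set G : (Fin n → ℝ) → ℝ≥0∞ := fun y => (∫⁻ s : ℝ, F (Fin.cons s y) ^ p 0) ^ (1 / p 0) with hG
    have hGm : Measurable G := ((hFc.pow_const (p 0)).lintegral_prod_right'
            (ν := (volume : Measure ℝ))).pow_const (1 / p 0)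
    have hT : ENNReal.ofReal (2 * t) ≠ 0 := by simp [ht]
    rw [lintegral_fin_succ hF, mixedNorm]
    calc ∫⁻ y : Fin n → ℝ, ∫⁻ s : ℝ, F (Fin.cons s y)
        ≤ ∫⁻ y, ENNReal.ofReal (2 * t) ^ (1 - 1 / p 0) * G y := by
          refine lintegral_mono fun y => ?_
          have hFy : Measurable fun s : ℝ => F (Fin.cons s y) :=
            hFc.comp (measurable_const.prodMk measurable_id)
          have hsupp : ∀ s : ℝ, ¬ |s| < t → F (Fin.cons s y) = 0 := fun s hs =>
            hFt _ fun h => hs (by simpa using h 0)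
          rw [lintegral_eq_of_forall_abs_lt hsupp]
          have h := ENNReal.lintegral_mul_le_Lp_mul_Lq (volume.restrict (Ioo (-t) t)) hpq
            hFy.aemeasurable (aemeasurable_const (b := (1 : ℝ≥0∞)))
          simp only [Pi.mul_apply, mul_one, ENNReal.one_rpow, lintegral_const, one_mul,
            Measure.restrict_apply_univ, Real.volume_Ioo, sub_neg_eq_add, ← two_mul] at h
          refine h.trans ?_
          rw [mul_comm, one_div (p 0).conjExponent, ← hpq.one_sub_inv, ← one_div]
          simp only [hG]
          gcongr
          exact Measure.restrict_le_self
      _ = ENNReal.ofReal (2 * t) ^ (1 - 1 / p 0) * ∫⁻ y, G y := lintegral_const_mul _ hGm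
      _ ≤ ENNReal.ofReal (2 * t) ^ (1 - 1 / p 0) *
            (ENNReal.ofReal (2 * t) ^ (∑ i : Fin n, (1 - 1 / p i.succ)) *
              mixedNorm n (fun i => p i.succ) G) := by
          gcongr
          refine lintegral_le_mixedNorm (fun i => hp i.succ) ht hGm fun y hy => ?_
          have : ∀ s : ℝ, F (Fin.cons s y) = 0 := fun s =>
            hFt _ fun h => hy fun i => by simpa using h i.succ
          simp [hG, this, show 0 < p 0 by linarith]
      _ = _ := by
          rw [Fin.sum_univ_succ, ENNReal.rpow_add _ _ hT ENNReal.ofReal_ne_top, mul_assoc]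

open Classical in
theorem mixedNorm_const_cube : ∀ {n : ℕ} {p : Fin n → ℝ}, (∀ i, 1 < p i) → ∀ {r : ℝ}, 0 < r →
    ∀ D : ℝ≥0∞, mixedNorm n p (fun x => if ∀ i, |x i| < r then D else 0) =
      ENNReal.ofReal (2 * r) ^ (∑ i, 1 / p i) * D
  | 0, _, _, _, _, D => by simp [mixedNorm]
  | n + 1, p, hp, r, hr, D => by
    have hp0 : 0 < p 0 := by linarith [hp 0]
    have hT : ENNReal.ofReal (2 * r) ≠ 0 := by simp [hr]
    have h1 : ∀ y : Fin n → ℝ, (∫⁻ s : ℝ, (if ∀ i, |(Fin.cons s y : Fin (n + 1) → ℝ) i| < r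
        then D else 0) ^ p 0) ^ (1 / p 0) =
        if ∀ i, |y i| < r then ENNReal.ofReal (2 * r) ^ (1 / p 0) * D else 0 := by
      intro y
      simp only [Fin.forall_fin_succ, Fin.cons_zero, Fin.cons_succ]
      by_cases hy : ∀ i, |y i| < r
      · simp only [hy, implies_true, and_true, if_true]
        rw [lintegral_eq_of_forall_abs_lt (t := r) (fun s hs => by simp [hs, hp0])]
        rw [setLIntegral_congr_fun (g := fun _ => D ^ p 0) measurableSet_Ioo
          (fun s hs => by simp [abs_lt.mpr hs])]
        rw [setLIntegral_const, Real.volume_Ioo, sub_neg_eq_add, ← two_mul,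
          ENNReal.mul_rpow_of_nonneg _ _ (by positivity), ← ENNReal.rpow_mul,
          mul_one_div_cancel hp0.ne', ENNReal.rpow_one, mul_comm]
      · simp [hy, hp0]
    rw [mixedNorm]
    simp_rw [h1]
    rw [mixedNorm_const_cube (fun i => hp i.succ) hr, Fin.sum_univ_succ, ← mul_assoc,
      ← ENNReal.rpow_add _ _ hT ENNReal.ofReal_ne_top, add_comm]

theorem cube_subset_cube {n : ℕ} {r s : ℝ} (h : r ≤ s) : cube n r ⊆ cube n s :=
  fun _ hx i => (hx i).trans_le h

theorem measurableSet_cube (n : ℕ) (r : ℝ) : MeasurableSet (cube n r) := by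
  have : cube n r = ⋂ i, {x | |x i| < r} := by ext; simp [cube]
  rw [this]
  exact MeasurableSet.iInter fun i => measurableSet_lt (by fun_prop) measurable_const

section cubeNorm

variable {n : ℕ} {p : Fin n → ℝ} {F G : EuclideanSpace ℝ (Fin n) → ℝ≥0∞}

theorem cubeNorm_monotone (hp : ∀ i, 1 < p i) : Monotone (cubeNorm p F) := fun _ _ hrs =>
  mixedNorm_mono hp fun _ =>
    indicator_le_indicator_of_subset (cube_subset_cube hrs) (fun _ => zero_le) _

theorem cubeNorm_congr_ae (hp : ∀ i, 1 < p i) (h : F =ᵐ[volume] G) : cubeNorm p F = cubeNorm p G := by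
  funext r
  refine mixedNorm_congr_ae hp ?_
  filter_upwards [(PiLp.volume_preserving_toLp (Fin n)).quasiMeasurePreserving.ae_eq_comp h] with x hx
  have hx' : F (WithLp.toLp 2 x) = G (WithLp.toLp 2 x) := hx
  simp only [indicator, hx']

theorem setLIntegral_cube_le (hp : ∀ i, 1 < p i) (hF : Measurable F) {t : ℝ} (ht : 0 < t) :
    ∫⁻ y in cube n t, F y ≤
      ENNReal.ofReal (2 * t) ^ (n - ∑ i, 1 / p i) * cubeNorm p F t := by
  have hm : Measurable ((cube n t).indicator F) := hF.indicator (measurableSet_cube n t)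
  have h := lintegral_le_mixedNorm hp ht (hm.comp (WithLp.measurable_toLp 2 _)) 
    (fun x hx => indicator_of_notMem (show WithLp.toLp 2 x ∉ cube n t from hx) _)
  rw [← lintegral_indicator (measurableSet_cube n t),
    ← (PiLp.volume_preserving_toLp (Fin n)).lintegral_comp hm]
  rw [Finset.sum_sub_distrib, Finset.sum_const, Finset.card_univ, Fintype.card_fin, nsmul_one] at h
  exact h

end cubeNorm

/-! ### The pointwise estimates for the maximal function on a cube -/

theorem maximal_congr_ae {n : ℕ} {F G : EuclideanSpace ℝ (Fin n) → ℝ≥0∞} (h : F =ᵐ[volume] G) :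
    maximal F = maximal G := by
  funext x
  simp only [maximal, lintegral_congr_ae (ae_restrict_of_ae h)]

theorem maximal_add_le {n : ℕ} {F G : EuclideanSpace ℝ (Fin n) → ℝ≥0∞} (hF : Measurable F)
    (x : EuclideanSpace ℝ (Fin n)) :
    maximal (fun y => F y + G y) x ≤ maximal F x + maximal G x := by
  refine iSup_le fun c => iSup_le fun ρ => iSup_le fun hx => ?_
  rw [lintegral_add_left hF, ENNReal.add_div]
  refine add_le_add ?_ ?_
  · exact le_iSup_of_le c (le_iSup_of_le ρ (le_iSup_of_le hx le_rfl))
  · exact le_iSup_of_le c (le_iSup_of_le ρ (le_iSup_of_le hx le_rfl))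

/-- The kernel that controls averages over balls which reach out of a large cube. -/
noncomputable def tailKernel (n : ℕ) (r : ℝ) (y : EuclideanSpace ℝ (Fin n)) : ℝ≥0∞ :=
  ∫⁻ t in Ioi (2 * r), (cube n t).indicator (fun _ => ENNReal.ofReal (t ^ (-(n : ℝ) - 1))) y

theorem lintegral_Ioi_rpow_neg {n : ℕ} (hn : 1 ≤ n) {a : ℝ} (ha : 0 < a) :
    ∫⁻ t in Ioi a, ENNReal.ofReal (t ^ (-(n : ℝ) - 1)) = (n * ENNReal.ofReal a ^ n)⁻¹ := by
  have hn' : (0 : ℝ) < n := by exact_mod_cast hn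
  rw [← ofReal_integral_eq_lintegral_ofReal (integrableOn_Ioi_rpow_of_lt (by linarith) ha)]
  · rw [integral_Ioi_rpow_of_lt (by linarith) ha, sub_add_cancel, neg_div_neg_eq,
      Real.rpow_neg ha.le, Real.rpow_natCast, ← ENNReal.ofReal_natCast n, ← ENNReal.ofReal_pow ha.le,
      ← ENNReal.ofReal_mul hn'.le, ← ENNReal.ofReal_inv_of_pos (by positivity)]
    congr 1
    rw [mul_inv, div_eq_mul_inv, mul_comm]
  · filter_upwards [ae_restrict_mem measurableSet_Ioi] with t ht
    exact Real.rpow_nonneg (ha.le.trans (le_of_lt ht)) _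

theorem measurable_indicator_cube (n : ℕ) : Measurable fun z : EuclideanSpace ℝ (Fin n) × ℝ =>
    (cube n z.2).indicator (fun _ => ENNReal.ofReal (z.2 ^ (-(n : ℝ) - 1))) z.1 := by
  have hs : MeasurableSet {z : EuclideanSpace ℝ (Fin n) × ℝ | z.1 ∈ cube n z.2} := by
    have : {z : EuclideanSpace ℝ (Fin n) × ℝ | z.1 ∈ cube n z.2} = ⋂ i, {z | |z.1 i| < z.2} := by
      ext; simp [cube]
    rw [this]
    exact MeasurableSet.iInter fun i => measurableSet_lt (by fun_prop) measurable_snd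
  have hm : Measurable fun z : EuclideanSpace ℝ (Fin n) × ℝ =>
      ENNReal.ofReal (z.2 ^ (-(n : ℝ) - 1)) := by fun_prop
  exact hm.indicator hs

theorem measurable_tailKernel (n : ℕ) (r : ℝ) : Measurable (tailKernel n r) :=
  (measurable_indicator_cube n).lintegral_prod_right' (ν := volume.restrict (Ioi (2 * r)))

/-- On a cube, the maximal function of a function that vanishes on the doubled cube is controlled
by a single integral. -/
theorem maximal_le_lintegral_tailKernel {n : ℕ} (hn : 1 ≤ n) {r : ℝ}
    {G : EuclideanSpace ℝ (Fin n) → ℝ≥0∞} (hG0 : ∀ y ∈ cube n (2 * r), G y = 0)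
    {x : EuclideanSpace ℝ (Fin n)} (hx : x ∈ cube n r) :
    maximal G x ≤ ballConst n * n * ∫⁻ y, G y * tailKernel n r y := by
  refine iSup_le fun c => iSup_le fun ρ => iSup_le fun hxc => ?_
  have hρ : 0 < ρ := Metric.pos_of_mem_ball hxc
  have hn0 : (n : ℝ≥0∞) ≠ 0 := by exact_mod_cast (by omega : n ≠ 0)
  have h4 : ENNReal.ofReal (4 * ρ) ^ n ≠ 0 := by simp [hρ]
  have h4t : ENNReal.ofReal (4 * ρ) ^ n ≠ ∞ :=
    ENNReal.pow_ne_top ENNReal.ofReal_ne_top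
  -- The ball contains `x` in Q(0,r) and `y` outside Q(0,2r), so r ≤ |y_i| - r < 2ρ for some
  -- coordinate. Hence `y` lies in Q(0,t) for all t > 4ρ, and the kernel is at least ∫_{4ρ}^∞
  -- t^(-n-1) dt = 1/(n (4ρ)^n).
  have hker : ∀ y ∈ Metric.ball c ρ, y ∉ cube n (2 * r) →
      1 ≤ n * ENNReal.ofReal (4 * ρ) ^ n * tailKernel n r y := by
    intro y hy hyr
    have hdist : ∀ i, |y i| < r + 2 * ρ := by
      intro i
      have h1 : ‖y - x‖ < 2 * ρ := by
        rw [← dist_eq_norm]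
        rw [Metric.mem_ball] at hy hxc
        have := dist_triangle_right y x c
        linarith
      have h2 : |y i - x i| < 2 * ρ := lt_of_le_of_lt (PiLp.norm_apply_le (y - x) i) h1
      have h3 := hx i
      have h5 := abs_sub_abs_le_abs_sub (y i) (x i)
      linarith
    have hrρ : r < 2 * ρ := by
      by_contra! hcon
      exact hyr fun i => (hdist i).trans_le (by linarith)
    have h6 : (n * ENNReal.ofReal (4 * ρ) ^ n)⁻¹ ≤ tailKernel n r y := by
      rw [← lintegral_Ioi_rpow_neg hn (by positivity), tailKernel]
      calc _ = ∫⁻ t in Ioi (4 * ρ),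
              (cube n t).indicator (fun _ => ENNReal.ofReal (t ^ (-(n : ℝ) - 1))) y := by
            refine setLIntegral_congr_fun measurableSet_Ioi fun t ht => ?_
            have : y ∈ cube n t := fun i => (hdist i).trans (by
              have : 4 * ρ < t := ht
              linarith)
            simp [this]
        _ ≤ _ := lintegral_mono_set (Ioi_subset_Ioi (by linarith))
    rw [← ENNReal.mul_inv_cancel (mul_ne_zero hn0 h4) (ENNReal.mul_ne_top (by simp) h4t)]
    gcongr
  calc (∫⁻ y in Metric.ball c ρ, G y) / volume (Metric.ball c ρ)
      ≤ (∫⁻ y in Metric.ball c ρ, n * ENNReal.ofReal (4 * ρ) ^ n * (G y * tailKernel n r y)) /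
          volume (Metric.ball c ρ) := by
        refine ENNReal.div_le_div_right ?_ _
        refine setLIntegral_mono' measurableSet_ball fun y hy => ?_
        by_cases hyr : y ∈ cube n (2 * r)
        · simp [hG0 y hyr]
        · calc G y = G y * 1 := (mul_one _).symm
            _ ≤ G y * (n * ENNReal.ofReal (4 * ρ) ^ n * tailKernel n r y) := by
              gcongr
              exact hker y hy hyr
            _ = _ := by ring
    _ ≤ (n * ENNReal.ofReal (4 * ρ) ^ n * ∫⁻ y, G y * tailKernel n r y) /
          volume (Metric.ball c ρ) := by
        gcongr
        rw [lintegral_const_mul' _ _ (ENNReal.mul_ne_top (by simp) h4t)]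
        gcongr
        exact Measure.restrict_le_self
    _ = _ := by
        rw [← div_volume_ball n c hρ, div_eq_mul_inv, div_eq_mul_inv]
        ring

/-! ### Sequence norms -/

/-- The `ℓ^v` norm of a sequence. -/
noncomputable def seqNorm (v : ℝ) (a : ℕ → ℝ≥0∞) : ℝ≥0∞ := (∑' j, a j ^ v) ^ (1 / v)

section seqNorm

variable {v : ℝ}

theorem seqNorm_mono (hv : 1 < v) {a b : ℕ → ℝ≥0∞} (h : ∀ j, a j ≤ b j) :
    seqNorm v a ≤ seqNorm v b := by
  unfold seqNorm
  gcongr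
  exact h _

theorem seqNorm_const_mul (hv : 1 < v) (c : ℝ≥0∞) (a : ℕ → ℝ≥0∞) :
    seqNorm v (fun j => c * a j) = c * seqNorm v a := by
  have hv0 : 0 < v := by linarith
  simp_rw [seqNorm, ENNReal.mul_rpow_of_nonneg _ _ hv0.le]
  rw [ENNReal.tsum_mul_left, ENNReal.mul_rpow_of_nonneg _ _ (by positivity), ← ENNReal.rpow_mul,
    mul_one_div_cancel hv0.ne', ENNReal.rpow_one]

theorem seqNorm_add_le (hv : 1 < v) (a b : ℕ → ℝ≥0∞) :
    seqNorm v (fun j => a j + b j) ≤ seqNorm v a + seqNorm v b := by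
  have h := ENNReal.lintegral_Lp_add_le (μ := (Measure.count : Measure ℕ)) (f := a) (g := b)
    (Measurable.of_discrete.aemeasurable) (Measurable.of_discrete.aemeasurable) hv.le
  simpa only [lintegral_count, Pi.add_apply, seqNorm] using h

theorem seqNorm_lintegral_le (hv : 1 < v) {Y : Type*} [MeasurableSpace Y] {ν : Measure Y} [SFinite ν]
    {F : ℕ → Y → ℝ≥0∞} (hF : ∀ j, Measurable (F j)) :
    seqNorm v (fun j => ∫⁻ y, F j y ∂ν) ≤ ∫⁻ y, seqNorm v (fun j => F j y) ∂ν := by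
  have h := lintegral_lintegral_rpow_le (μ := (Measure.count : Measure ℕ)) (ν := ν) hv
    (φ := F) (measurable_from_prod_countable_right hF)
  simpa only [lintegral_count, seqNorm] using h

theorem measurable_seqNorm {X : Type*} [MeasurableSpace X] {F : ℕ → X → ℝ≥0∞}
    (hF : ∀ j, Measurable (F j)) : Measurable fun x => seqNorm v fun j => F j x :=
  (Measurable.tsum fun j => (hF j).pow_const v).pow_const _

theorem seqNorm_single (hv : 1 < v) {a : ℕ → ℝ≥0∞} (h : ∀ j, j ≠ 0 → a j = 0) :
    seqNorm v a = a 0 := by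
  have hv0 : 0 < v := by linarith
  rw [seqNorm, tsum_eq_single 0 fun j hj => by simp [h j hj, hv0], ← ENNReal.rpow_mul,
    mul_one_div_cancel hv0.ne', ENNReal.rpow_one]

theorem seqNorm_zero (hv : 1 < v) : seqNorm v (fun _ => 0) = 0 :=
  seqNorm_single hv fun _ _ => rfl

end seqNorm

/-! ### The local estimate -/

section localEstimate

variable {n : ℕ} {p : Fin n → ℝ} {v : ℝ}

/-- Cube norms increase with the radius, so the part 2r < t < 4r of the Hardy integral is at least
(4r)^(-σ-1) · 2r times the norm at 2r. The constant 2 · 4^σ is the reciprocal of this factor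
multiplied by r^σ. -/
theorem cubeNorm_le_hardyDual (hp : ∀ i, 1 < p i) :
    ∃ C : ℝ≥0, ∀ S : EuclideanSpace ℝ (Fin n) → ℝ≥0∞, ∀ r : ℝ, 0 < r →
      cubeNorm p S (2 * r) ≤ C * ENNReal.ofReal (r ^ ∑ i, 1 / p i) *
        hardyDual (fun t => ENNReal.ofReal (t ^ (-(∑ i, 1 / p i) - 1)) * cubeNorm p S t) r := by
  set σ := ∑ i, 1 / p i
  have hσ0 : 0 ≤ σ := Finset.sum_nonneg fun i _ => by
    have := hp i
    positivity
  refine ⟨(2 * 4 ^ σ : ℝ).toNNReal, fun S r hr => ?_⟩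
  have h1 : ENNReal.ofReal ((4 * r) ^ (-σ - 1) * (2 * r)) * cubeNorm p S (2 * r) ≤
      hardyDual (fun t => ENNReal.ofReal (t ^ (-σ - 1)) * cubeNorm p S t) r := by
    calc _ = ∫⁻ t in Ioo (2 * r) (4 * r), ENNReal.ofReal ((4 * r) ^ (-σ - 1)) *
            cubeNorm p S (2 * r) := by
          rw [setLIntegral_const, Real.volume_Ioo, ENNReal.ofReal_mul (by positivity)]
          rw [show 4 * r - 2 * r = 2 * r by ring]
          ring
      _ ≤ ∫⁻ t in Ioo (2 * r) (4 * r), ENNReal.ofReal (t ^ (-σ - 1)) * cubeNorm p S t := by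
          refine setLIntegral_mono' measurableSet_Ioo fun t ht => ?_
          refine mul_le_mul' (ENNReal.ofReal_le_ofReal ?_) (cubeNorm_monotone hp ht.1.le)
          exact Real.rpow_le_rpow_of_nonpos (by linarith [ht.1]) ht.2.le (by linarith)
      _ ≤ _ := lintegral_mono_set fun t ht => show r < t by linarith [ht.1]
  have h2 : 2 * 4 ^ σ * r ^ σ * ((4 * r) ^ (-σ - 1) * (2 * r)) = 1 := by
    rw [Real.rpow_sub_one (by positivity), Real.rpow_neg (by positivity),
      Real.mul_rpow (by norm_num) hr.le]
    have : (4 : ℝ) ^ σ ≠ 0 := by positivity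
    have : r ^ σ ≠ 0 := by positivity
    field_simp
    norm_num
  calc cubeNorm p S (2 * r) = ENNReal.ofReal (2 * 4 ^ σ) * ENNReal.ofReal (r ^ σ) *
        (ENNReal.ofReal ((4 * r) ^ (-σ - 1) * (2 * r)) * cubeNorm p S (2 * r)) := by
        rw [← mul_assoc, ← ENNReal.ofReal_mul (by positivity), ← ENNReal.ofReal_mul (by positivity),
          h2, ENNReal.ofReal_one, one_mul]
    _ ≤ _ := by
        rw [ENNReal.ofReal]
        exact mul_le_mul' le_rfl h1

/-- The kernel is a superposition of indicators of cubes, so Tonelli produces t^(-n-1) ∫_{Q(0,t)} S.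
Hölder on the cube costs (2t)^(n-σ), which leaves t^(-σ-1). -/
theorem lintegral_mul_tailKernel_le (hp : ∀ i, 1 < p i) : ∃ C : ℝ≥0,
    ∀ S : EuclideanSpace ℝ (Fin n) → ℝ≥0∞, Measurable S → ∀ r : ℝ, 0 < r →
      ∫⁻ y, S y * tailKernel n r y ≤ C *
        hardyDual (fun t => ENNReal.ofReal (t ^ (-(∑ i, 1 / p i) - 1)) * cubeNorm p S t) r := by
  set σ := ∑ i, 1 / p i
  refine ⟨(2 ^ ((n : ℝ) - σ) : ℝ).toNNReal, fun S hS r hr => ?_⟩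
  have hc : ∀ y, Measurable fun t : ℝ =>
      (cube n t).indicator (fun _ => ENNReal.ofReal (t ^ (-(n : ℝ) - 1))) y := fun y =>
    (measurable_indicator_cube n).comp (measurable_const.prodMk measurable_id)
  calc ∫⁻ y, S y * tailKernel n r y
      = ∫⁻ y, ∫⁻ t in Ioi (2 * r), S y *
          (cube n t).indicator (fun _ => ENNReal.ofReal (t ^ (-(n : ℝ) - 1))) y := by
        refine lintegral_congr fun y => ?_
        rw [tailKernel, lintegral_const_mul _ (hc y)]
    _ = ∫⁻ t in Ioi (2 * r), ∫⁻ y, S y *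
          (cube n t).indicator (fun _ => ENNReal.ofReal (t ^ (-(n : ℝ) - 1))) y :=
        lintegral_lintegral_swap
          ((hS.comp measurable_fst).mul (measurable_indicator_cube n)).aemeasurable
    _ ≤ ∫⁻ t in Ioi (2 * r), ENNReal.ofReal (2 ^ ((n : ℝ) - σ)) *
          (ENNReal.ofReal (t ^ (-σ - 1)) * cubeNorm p S t) := by
        refine setLIntegral_mono' measurableSet_Ioi fun t ht => ?_
        have ht0 : 0 < t := lt_trans (by positivity) ht
        calc ∫⁻ y, S y * (cube n t).indicator (fun _ => ENNReal.ofReal (t ^ (-(n : ℝ) - 1))) y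
            = ENNReal.ofReal (t ^ (-(n : ℝ) - 1)) * ∫⁻ y in cube n t, S y := by
              rw [← lintegral_const_mul _ hS, ← lintegral_indicator (measurableSet_cube n t)]
              refine lintegral_congr fun y => ?_
              by_cases hy : y ∈ cube n t <;> simp [hy, mul_comm]
          _ ≤ ENNReal.ofReal (t ^ (-(n : ℝ) - 1)) *
                (ENNReal.ofReal (2 * t) ^ (n - σ) * cubeNorm p S t) := by
              gcongr
              exact setLIntegral_cube_le hp hS ht0
          _ = _ := by
              rw [← mul_assoc, ← mul_assoc, ENNReal.ofReal_rpow_of_pos (by positivity),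
                ← ENNReal.ofReal_mul (by positivity), ← ENNReal.ofReal_mul (by positivity)]
              congr 2
              rw [Real.mul_rpow (by norm_num) ht0.le, mul_left_comm, ← Real.rpow_add ht0]
              congr 2
              ring
    _ = ENNReal.ofReal (2 ^ ((n : ℝ) - σ)) * ∫⁻ t in Ioi (2 * r),
          (ENNReal.ofReal (t ^ (-σ - 1)) * cubeNorm p S t) :=
        lintegral_const_mul' _ _ ENNReal.ofReal_ne_top
    _ ≤ _ := by
        rw [ENNReal.ofReal]
        exact mul_le_mul' le_rfl (lintegral_mono_set (Ioi_subset_Ioi (by linarith)))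

/-- The local estimate: the mixed norm on a cube of the vector-valued maximal function is controlled
by the dual Hardy operator applied to the mixed norms on larger cubes. -/
theorem cubeNorm_seqNorm_maximal_le (hn : 1 ≤ n) (hp : ∀ i, 1 < p i) (hv : 1 < v) : ∃ C : ℝ≥0,
    ∀ F : ℕ → EuclideanSpace ℝ (Fin n) → ℝ≥0∞, (∀ j, Measurable (F j)) → ∀ r : ℝ, 0 < r →
      cubeNorm p (fun x => seqNorm v fun j => maximal (F j) x) r ≤
        C * ENNReal.ofReal (r ^ ∑ i, 1 / p i) *
          hardyDual (fun t => ENNReal.ofReal (t ^ (-(∑ i, 1 / p i) - 1)) *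
            cubeNorm p (fun x => seqNorm v fun j => F j x) t) r := by
  classical
  obtain ⟨C₁, hC₁⟩ := exists_mixedNorm_tsum_iterMax_le hp hv
  obtain ⟨C₂, hC₂⟩ := cubeNorm_le_hardyDual hp
  obtain ⟨C₃, hC₃⟩ := lintegral_mul_tailKernel_le hp
  set σ := ∑ i, 1 / p i
  have hσ0 : 0 ≤ σ := Finset.sum_nonneg fun i _ => by
    have := hp i
    positivity
  set b : ℝ≥0 := (ballConst n).toNNReal
  have hbc : ballConst n = b := (ENNReal.coe_toNNReal (ballConst_ne_top n)).symm
  refine ⟨2 ^ n * (b * C₁ * C₂ + (2 ^ σ : ℝ).toNNReal * (b * n * C₃)), fun F hF r hr => ?_⟩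
  set S : EuclideanSpace ℝ (Fin n) → ℝ≥0∞ := fun x => seqNorm v fun j => F j x with hS
  set R := hardyDual (fun t => ENNReal.ofReal (t ^ (-σ - 1)) * cubeNorm p S t) r
  have hSm : Measurable S := measurable_seqNorm hF
  set F₁ : ℕ → EuclideanSpace ℝ (Fin n) → ℝ≥0∞ := fun j => (cube n (2 * r)).indicator (F j) with hF₁
  set F₂ : ℕ → EuclideanSpace ℝ (Fin n) → ℝ≥0∞ := fun j => (cube n (2 * r))ᶜ.indicator (F j) with hF₂
  have hF₁m : ∀ j, Measurable (F₁ j) := fun j => (hF j).indicator (measurableSet_cube n _)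
  have hF₂m : ∀ j, Measurable (F₂ j) := fun j => (hF j).indicator (measurableSet_cube n _).compl
  have hsplit : ∀ j x, maximal (F j) x ≤ maximal (F₁ j) x + maximal (F₂ j) x := by
    intro j x
    have : F j = fun y => F₁ j y + F₂ j y := by
      funext y
      exact (congrFun (indicator_self_add_compl (cube n (2 * r)) (F j)) y).symm
    rw [this]
    exact maximal_add_le (hF₁m j) x
  -- The bound for the far parts is the same at all points of Q(0,r), so its mixed norm there is
  -- (2r)^σ D; this is one source of the factor r^σ.
  set D : ℝ≥0∞ := b * n * (C₃ * R) with hD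
  have hfar : ∀ x ∈ cube n r, seqNorm v (fun j => maximal (F₂ j) x) ≤ D := by
    intro x hx
    calc seqNorm v (fun j => maximal (F₂ j) x)
        ≤ seqNorm v (fun j => b * n * ∫⁻ y, F₂ j y * tailKernel n r y) := by
          refine seqNorm_mono hv fun j => ?_
          rw [← hbc]
          exact maximal_le_lintegral_tailKernel hn (fun y hy => by simp [hF₂, hy]) hx
      _ ≤ b * n * ∫⁻ y, seqNorm v (fun j => F₂ j y * tailKernel n r y) := by
          rw [seqNorm_const_mul hv]
          gcongr
          exact seqNorm_lintegral_le hv fun j => (hF₂m j).mul (measurable_tailKernel n r)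
      _ ≤ b * n * ∫⁻ y, S y * tailKernel n r y := by
          gcongr with y
          simp_rw [mul_comm _ (tailKernel n r y)]
          rw [seqNorm_const_mul hv]
          gcongr
          exact seqNorm_mono hv fun j => indicator_le_self _ _ _
      _ ≤ D := by
          rw [hD]
          gcongr
          exact hC₃ S hSm r hr
  -- The localisation to Q(0,r) is dropped: Fefferman–Stein on the whole space suffices, since the
  -- truncated functions live on Q(0,2r).
  have hnear : mixedNorm n p (fun x => seqNorm v fun j => maximal (F₁ j) (WithLp.toLp 2 x)) ≤
      b * C₁ * cubeNorm p S (2 * r) := by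
    calc _ ≤ mixedNorm n p (fun x => b * seqNorm v fun j =>
            iterMax n (fun y => F₁ j (WithLp.toLp 2 y)) x) := by
          refine mixedNorm_mono hp fun x => ?_
          rw [← seqNorm_const_mul hv, ← hbc]
          exact seqNorm_mono hv fun j => maximal_le_iterMax (hF₁m j) _
      _ = b * mixedNorm n p (fun x => seqNorm v fun j =>
            iterMax n (fun y => F₁ j (WithLp.toLp 2 y)) x) :=
          mixedNorm_const_mul hp _ ENNReal.coe_ne_top _
      _ ≤ b * (C₁ * mixedNorm n p (fun x => seqNorm v fun j => F₁ j (WithLp.toLp 2 x))) := by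
          gcongr
          exact hC₁ _ fun j => (hF₁m j).comp (WithLp.measurable_toLp 2 _)
      _ = b * C₁ * cubeNorm p S (2 * r) := by
          rw [mul_assoc, cubeNorm]
          congr 3
          funext x
          by_cases hx : WithLp.toLp 2 x ∈ cube n (2 * r)
          · simp [hF₁, hS, hx]
          · simp only [hF₁, hx, not_false_eq_true, indicator_of_notMem]
            exact seqNorm_zero hv
  set G : (Fin n → ℝ) → ℝ≥0∞ := fun x => if ∀ i, |x i| < r then D else 0 with hG
  have hGm : Measurable G := by
    refine Measurable.ite ?_ measurable_const measurable_const
    have : {x : Fin n → ℝ | ∀ i, |x i| < r} = ⋂ i, {x | |x i| < r} := by ext; simp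
    rw [this]
    exact MeasurableSet.iInter fun i => measurableSet_lt (by fun_prop) measurable_const
  calc cubeNorm p (fun x => seqNorm v fun j => maximal (F j) x) r
      ≤ mixedNorm n p (fun x => (seqNorm v fun j => maximal (F₁ j) (WithLp.toLp 2 x)) + G x) := by
        refine mixedNorm_mono hp fun x => ?_
        by_cases hx : WithLp.toLp 2 x ∈ cube n r
        · have hx' : ∀ i, |x i| < r := hx
          rw [indicator_of_mem hx, hG]
          simp only [hx', implies_true, if_true]
          calc _ ≤ seqNorm v (fun j => maximal (F₁ j) (WithLp.toLp 2 x) +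
                  maximal (F₂ j) (WithLp.toLp 2 x)) := seqNorm_mono hv fun j => hsplit j _
            _ ≤ _ := (seqNorm_add_le hv _ _).trans (add_le_add le_rfl (hfar _ hx))
        · rw [indicator_of_notMem hx]
          exact zero_le
    _ ≤ 2 ^ n * (b * C₁ * cubeNorm p S (2 * r) + ENNReal.ofReal (2 * r) ^ σ * D) := by
        refine (mixedNorm_add_le hp hGm).trans ?_
        gcongr
        exact (mixedNorm_const_cube hp hr D).le
    _ ≤ 2 ^ n * (b * C₁ * (C₂ * ENNReal.ofReal (r ^ σ) * R) + ENNReal.ofReal (2 * r) ^ σ * D) := by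
        gcongr
        exact hC₂ S r hr
    _ = _ := by
        rw [ENNReal.ofReal_rpow_of_pos (by positivity), Real.mul_rpow (by norm_num) hr.le,
          ENNReal.ofReal_mul (by positivity), hD,
          show ENNReal.ofReal (2 ^ σ) = ((2 ^ σ : ℝ).toNNReal : ℝ≥0∞) from rfl]
        push_cast
        ring

end localEstimate

/-! ### Boundedness on local Morrey-type spaces -/

/-- The vector-valued maximal inequality in local mixed Morrey-type spaces, for non-negative
functions that may take the value `∞`. -/
theorem exists_lmNorm_seqNorm_maximal_le {n : ℕ} (hn : 1 ≤ n) {p : Fin n → ℝ} (hp : ∀ i, 1 < p i)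
    {θ : ℝ≥0∞} {v : ℝ} (hv : 1 < v) {w : ℝ → ℝ}
    (hH : HardyDualBounded θ (fun r => r ^ ((∑ i, 1 / p i) + 1) * w r)
      (fun r => r ^ (∑ i, 1 / p i) * w r)) :
    ∃ C : ℝ≥0, ∀ F : ℕ → EuclideanSpace ℝ (Fin n) → ℝ≥0∞, (∀ j, AEMeasurable (F j) volume) →
      lmNorm p θ w (fun x => seqNorm v fun j => maximal (F j) x) ≤
        C * lmNorm p θ w fun x => seqNorm v fun j => F j x := by
  obtain ⟨A, hA⟩ := hH
  obtain ⟨C, hC⟩ := cubeNorm_seqNorm_maximal_le hn hp hv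
  set σ := ∑ i, 1 / p i
  refine ⟨C * A, fun F hF => ?_⟩
  -- Neither the maximal function nor the cube norms see null sets, so measurable representatives
  -- may be used.
  have hmax : ∀ j, maximal (F j) = maximal ((hF j).mk _) := fun j => maximal_congr_ae (hF j).ae_eq_mk
  have hcube : cubeNorm p (fun x => seqNorm v fun j => F j x) =
      cubeNorm p (fun x => seqNorm v fun j => (hF j).mk _ x) := by
    refine cubeNorm_congr_ae hp ?_
    filter_upwards [ae_all_iff.mpr fun j => (hF j).ae_eq_mk] with x hx
    simp only [hx]
  set S : EuclideanSpace ℝ (Fin n) → ℝ≥0∞ := fun x => seqNorm v fun j => (hF j).mk _ x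
  -- The power of `t` cancels the first Hardy weight up to `w`, so the right side of the Hardy
  -- inequality is the Morrey norm of `S` itself. Measurability comes from monotonicity of the cube
  -- norms.
  set g : ℝ → ℝ≥0∞ := fun t => ENNReal.ofReal (t ^ (-σ - 1)) * cubeNorm p S t with hg
  have hgm : Measurable g :=
    (by fun_prop : Measurable fun t : ℝ => ENNReal.ofReal (t ^ (-σ - 1))).mul
      (cubeNorm_monotone hp).measurable
  have hv1 : weightedNorm θ (fun r => r ^ (σ + 1) * w r) g = weightedNorm θ w (cubeNorm p S) := by
    refine eLpNorm_congr_ae ?_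
    filter_upwards [ae_restrict_mem measurableSet_Ioi] with r hr
    have hr0 : (0 : ℝ) < r := hr
    rw [enorm_mul, Real.enorm_of_nonneg (by positivity), hg]
    have h1 : ENNReal.ofReal (r ^ (σ + 1)) * ENNReal.ofReal (r ^ (-σ - 1)) = 1 := by
      rw [← ENNReal.ofReal_mul (by positivity), ← Real.rpow_add hr0]
      simp
    calc _ = (ENNReal.ofReal (r ^ (σ + 1)) * ENNReal.ofReal (r ^ (-σ - 1))) *
          (‖w r‖ₑ * cubeNorm p S r) := by ring
      _ = _ := by rw [h1, one_mul]
  simp only [lmNorm, hmax, hcube]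
  rw [← hv1, ENNReal.coe_mul, mul_assoc]
  refine le_trans ?_ (mul_le_mul' le_rfl (hA g hgm))
  refine (eLpNorm_le_nnreal_smul_eLpNorm_of_ae_le_mul' (c := C)
    (g := fun r => ‖r ^ σ * w r‖ₑ * hardyDual g r) ?_ θ).trans (le_of_eq rfl)
  · filter_upwards [ae_restrict_mem measurableSet_Ioi] with r hr
    have hr0 : (0 : ℝ) < r := hr
    rw [enorm_eq_self, enorm_eq_self, enorm_mul,
      Real.enorm_of_nonneg (Real.rpow_nonneg hr0.le σ)]
    calc _ ≤ ‖w r‖ₑ * (C * ENNReal.ofReal (r ^ σ) * hardyDual g r) := by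
          gcongr
          exact hC _ (fun j => (hF j).measurable_mk) r hr0
      _ = _ := by ring

/-- The maximal inequality in local mixed Morrey-type spaces, for non-negative functions that may
take the value `∞`. -/
theorem exists_lmNorm_maximal_le {n : ℕ} (hn : 1 ≤ n) {p : Fin n → ℝ} (hp : ∀ i, 1 < p i)
    {θ : ℝ≥0∞} {w : ℝ → ℝ}
    (hH : HardyDualBounded θ (fun r => r ^ ((∑ i, 1 / p i) + 1) * w r)
      (fun r => r ^ (∑ i, 1 / p i) * w r)) :
    ∃ C : ℝ≥0, ∀ F : EuclideanSpace ℝ (Fin n) → ℝ≥0∞, AEMeasurable F volume →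
      lmNorm p θ w (maximal F) ≤ C * lmNorm p θ w F := by
  -- Apply the vector-valued inequality to (F, 0, 0, …); the exponent 2 is arbitrary, as any
  -- exponent above 1 would do.
  obtain ⟨C, hC⟩ := exists_lmNorm_seqNorm_maximal_le hn hp one_lt_two hH
  refine ⟨C, fun F hF => ?_⟩
  have h := hC (fun j => if j = 0 then F else fun _ => 0) fun j => by
    split_ifs
    exacts [hF, aemeasurable_const]
  have h1 : ∀ x, seqNorm 2 (fun j => maximal (if j = 0 then F else fun _ => 0) x) = maximal F x :=
    fun x => by
      rw [seqNorm_single one_lt_two fun j hj => by simp [hj, maximal]]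
      simp
  have h2 : ∀ x, seqNorm 2 (fun j => (if j = 0 then F else fun _ => 0) x) = F x := fun x => by
    rw [seqNorm_single one_lt_two fun j hj => by simp [hj]]
    simp
  simpa only [h1, h2] using h

end LocalMixedMorrey

theorem theorem3p1 (n : ℕ) (hn : 1 ≤ n) (p : Fin n → ℝ) (hp : ∀ i, 1 < p i)
    (θ : ℝ≥0∞) (hθ : 1 < θ) (v : ℝ) (hv : 1 < v)
    (w : ℝ → ℝ) (hw_nonneg : ∀ r, 0 < r → 0 ≤ w r)
    (hw_meas : AEMeasurable w (volume.restrict (Ioi 0)))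
    (hH : LocalMixedMorrey.HardyDualBounded θ
      (fun r => r ^ ((∑ i, 1 / p i) + 1) * w r) (fun r => r ^ (∑ i, 1 / p i) * w r)) :
    (∃ C : ℝ≥0, ∀ f : EuclideanSpace ℝ (Fin n) → ℂ, AEMeasurable f volume →
      LocalMixedMorrey.lmNorm p θ w (LocalMixedMorrey.maximal fun x => ‖f x‖ₑ) ≤
        C * LocalMixedMorrey.lmNorm p θ w fun x => ‖f x‖ₑ) ∧
    (∃ C : ℝ≥0, ∀ f : ℕ → EuclideanSpace ℝ (Fin n) → ℂ, (∀ j, AEMeasurable (f j) volume) →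
      LocalMixedMorrey.lmNorm p θ w
          (fun x => (∑' j, LocalMixedMorrey.maximal (fun y => ‖f j y‖ₑ) x ^ v) ^ (1 / v)) ≤
        C * LocalMixedMorrey.lmNorm p θ w fun x => (∑' j, ‖f j x‖ₑ ^ v) ^ (1 / v)) ∧
    (∃ C : ℝ≥0, ∀ f : ℕ → EuclideanSpace ℝ (Fin n) → ℂ, (∀ j, AEMeasurable (f j) volume) →
      LocalMixedMorrey.lmNorm p θ w (LocalMixedMorrey.maximal fun x => ⨆ j, ‖f j x‖ₑ) ≤
        C * LocalMixedMorrey.lmNorm p θ w fun x => ⨆ j, ‖f j x‖ₑ) := by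
  refine ⟨?_, ?_, ?_⟩
  · obtain ⟨C, hC⟩ := LocalMixedMorrey.exists_lmNorm_maximal_le hn hp hH
    exact ⟨C, fun f hf => hC _ hf.enorm⟩
  · obtain ⟨C, hC⟩ := LocalMixedMorrey.exists_lmNorm_seqNorm_maximal_le hn hp hv hH
    exact ⟨C, fun f hf => hC (fun j x => ‖f j x‖ₑ) fun j => (hf j).enorm⟩
  -- The supremum stands inside M, so this is the scalar inequality for sup |f_j|, which may take
  -- the value `∞`; hence the scalar result is stated for functions into `ℝ≥0∞`.
  · obtain ⟨C, hC⟩ := LocalMixedMorrey.exists_lmNorm_maximal_le hn hp hH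
    exact ⟨C, fun f hf => hC _ (AEMeasurable.iSup fun j => (hf j).enorm)⟩
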